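/- All graphs are finite, simple and undirected. A graph $H$ is a \emph{topological minor} of a graph $G$ if, up to isomorphism, $G$ can be obtained from $H$ by adding edges, adding isolated vertices, and performing elementary subdivisions (replacing an edge $uv$ by two edges $uw$, $wv$ with a new vertex $w$). $H$-topological minor containment (respectively $H$-subgraph containment) is the property of a graph $G$ of having $H$ as a topological minor (respectively as a not necessarily induced subgraph, up to isomorphism); the two are called equivalent if they hold for exactly the same graphs $G$. An edge of $H$ is \emph{internal} if it lies on a cycle or on a path joining two vertices of degree at least $3$; $\beta(H)$ denotes the number of internal edges of $H$. A quantum query algorithm accesses an input graph $G=(V,E)$ on $n$ labelled vertices through the unitary $|u,v,b\rangle\mapsto|u,v,b\oplus e\rangle$ for $u,v\in V$, where $e=1$ if and only if $uv\in E$, and the quantum query complexity of a property of $n$-vertex graphs is the least number of queries made by a quantum query algorithm that decides the property with two-sided error at most $1/3$ on every input. \textbf{Theorem.} Let $H$ be a graph. $H$-topological minor containment is not equivalent to $H$-subgraph containment if and only if $\beta(H)>0$. If $H$-topological minor containment is not equivalent to $H$-subgraph containment, then the quantum query complexity of $H$-topological minor containment on $n$-vertex graphs is $\Omega(n^{3/2})$: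 there are $c>0$ and $n_0$, depending only on $H$, such that for all $n\ge n_0$ it is at least $c\,n^{3/2}$. -/

import Mathlib

open scoped ENNReal

/-- The elementary subdivision of `G` at the pair `u, v`: the edge `uv` is replaced by the two edges
`uw` and `wv`, where `w = none` is a new vertex. -/
def elementarySubdivision {W : Type*} (G : SimpleGraph W) (u v : W) : SimpleGraph (Option W) :=
  (G.deleteEdges {s(u, v)}).map some ⊔
    SimpleGraph.edge (some u) none ⊔ SimpleGraph.edge none (some v)

/-- The graph `G` together with one new isolated vertex `none`. -/
def addIsolatedVertex {W : Type*} (G : SimpleGraph W) : SimpleGraph (Option W) :=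
  G.map some

/-- `IsTopologicalMinor H G`: up to isomorphism, `G` can be obtained from `H` by adding edges, adding
isolated vertices and performing elementary subdivisions, in any order and any number of times. -/
inductive IsTopologicalMinor {V : Type*} (H : SimpleGraph V) :
    ∀ {W : Type}, SimpleGraph W → Prop
  | self {W : Type} {G : SimpleGraph W} : (H ≃g G) → IsTopologicalMinor H G
  | iso {W W' : Type} {G : SimpleGraph W} {G' : SimpleGraph W'} :
      IsTopologicalMinor H G → (G ≃g G') → IsTopologicalMinor H G'
  | addEdges {W : Type} {G G' : SimpleGraph W} :
      IsTopologicalMinor H G → G ≤ G' → IsTopologicalMinor H G'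
  | addVertex {W : Type} {G : SimpleGraph W} :
      IsTopologicalMinor H G → IsTopologicalMinor H (addIsolatedVertex G)
  | subdivide {W : Type} {G : SimpleGraph W} {u v : W} :
      IsTopologicalMinor H G → G.Adj u v → IsTopologicalMinor H (elementarySubdivision G u v)

/-- The graph property "contains `H` as a topological minor": for each `n` a property of graphs on
`n` vertices. -/
def topologicalMinorContainment {V : Type*} (H : SimpleGraph V) (n : ℕ)
    (G : SimpleGraph (Fin n)) : Prop :=
  IsTopologicalMinor H G

/-- The graph property "contains `H` as a (not necessarily induced) subgraph". -/
def subgraphContainment {V : Type*} (H : SimpleGraph V) (n : ℕ) (G : SimpleGraph (Fin n)) : Prop :=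
  H.IsContained G

/-- Two graph properties are equivalent if the same graphs have them, for every number of
vertices. -/
def EquivalentProperties (P P' : ∀ n : ℕ, SimpleGraph (Fin n) → Prop) : Prop :=
  ∀ (n : ℕ) (G : SimpleGraph (Fin n)), P n G ↔ P' n G

/-- An edge is internal if it lies on a cycle or on a path joining two vertices of degree at
least 3. (The two end vertices are distinct, since a path from a vertex to itself has no edge.) -/
def IsInternalEdge {V : Type*} (G : SimpleGraph V) (e : Sym2 V) : Prop :=
  (∃ (u : V) (c : G.Walk u u), c.IsCycle ∧ e ∈ c.edges) ∨
    (∃ (u v : V) (p : G.Walk u v), 3 ≤ (G.neighborSet u).encard ∧ 3 ≤ (G.neighborSet v).encard ∧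
      p.IsPath ∧ e ∈ p.edges)

/-- The number `β(G)` of internal edges of a finite graph `G`. -/
noncomputable def internalEdgeCount {V : Type*} (G : SimpleGraph V) : ℕ :=
  {e ∈ G.edgeSet | IsInternalEdge G e}.ncard

/-- The computational basis of a quantum algorithm on `n`-vertex graphs: a query register
`(u, v, b)` and a workspace register with `w` basis states. -/
abbrev QBasis (n w : ℕ) : Type := (Fin n × Fin n × Bool) × Fin w

/-- The Hilbert space of the algorithm. -/
abbrev QState (n w : ℕ) : Type := EuclideanSpace ℂ (QBasis n w)

open Classical in
/-- The action of the black box on basis states: `(u, v, b)` goes to `(u, v, b ⊕ e)`, where `e = 1`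
if and only if `uv` is an edge. -/
noncomputable def oracleFun {n : ℕ} (G : SimpleGraph (Fin n)) (w : ℕ) (x : QBasis n w) :
    QBasis n w :=
  ((x.1.1, x.1.2.1, xor x.1.2.2 (decide (G.Adj x.1.1 x.1.2.1))), x.2)

theorem oracleFun_involutive {n : ℕ} (G : SimpleGraph (Fin n)) (w : ℕ) :
    Function.Involutive (oracleFun G w) := by
  rintro ⟨⟨u, v, b⟩, z⟩
  by_cases h : G.Adj u v <;> simp [oracleFun, h]

/-- The quantum black box, a unitary: the linear extension of `|x⟩ ↦ |oracleFun G w x⟩`. -/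
noncomputable def oracle {n : ℕ} (G : SimpleGraph (Fin n)) (w : ℕ) :
    QState n w ≃ₗᵢ[ℂ] QState n w :=
  LinearIsometryEquiv.piLpCongrLeft 2 ℂ ℂ (oracleFun_involutive G w).toPerm

theorem oracle_single {n : ℕ} (G : SimpleGraph (Fin n)) (w : ℕ) (x : QBasis n w) :
    oracle G w (EuclideanSpace.single x 1) = EuclideanSpace.single (oracleFun G w x) 1 := by
  simp [oracle]

/-- A quantum query algorithm on `n`-vertex graphs making `queries` queries. It starts in a basis
state, applies `U 0`, then alternates black box queries with the unitaries
`U 1, U 2, …, U queries` (the remaining `U t` play no role), which do not depend on the input graph,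
and finally measures in the computational basis, accepting if the outcome lies in `accept`. -/
structure QueryAlgorithm (n : ℕ) where
  queries : ℕ
  workspace : ℕ
  start : QBasis n workspace
  U : ℕ → (QState n workspace ≃ₗᵢ[ℂ] QState n workspace)
  accept : Finset (QBasis n workspace)

/-- The state after `t` queries to the graph `G` (and the application of `U t`). -/
noncomputable def QueryAlgorithm.stateAfter {n : ℕ} (A : QueryAlgorithm n)
    (G : SimpleGraph (Fin n)) : ℕ → QState n A.workspace
  | 0 => A.U 0 (EuclideanSpace.single A.start 1)
  | t + 1 => A.U (t + 1) (oracle G A.workspace (A.stateAfter G t))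

/-- The probability that the algorithm accepts the input graph `G`. -/
noncomputable def QueryAlgorithm.acceptProb {n : ℕ} (A : QueryAlgorithm n)
    (G : SimpleGraph (Fin n)) : ℝ :=
  ∑ x ∈ A.accept, ‖A.stateAfter G A.queries x‖ ^ 2

/-- The algorithm decides the property `P` with two-sided error at most `1/3`. -/
def QueryAlgorithm.Decides {n : ℕ} (A : QueryAlgorithm n) (P : SimpleGraph (Fin n) → Prop) : Prop :=
  ∀ G : SimpleGraph (Fin n),
    (P G → 2 / 3 ≤ A.acceptProb G) ∧ (¬ P G → A.acceptProb G ≤ 1 / 3)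

/-- The bounded-error quantum query complexity of a property of `n`-vertex graphs: the least number
of queries of a quantum query algorithm deciding it. -/
noncomputable def quantumQueryComplexity {n : ℕ} (P : SimpleGraph (Fin n) → Prop) : ℕ∞ :=
  ⨅ (A : QueryAlgorithm n) (_ : A.Decides P), (A.queries : ℕ∞)

/-! None of the operations that build topological minors decreases β
(`IsTopologicalMinor.finite_and_internalEdgeCount_le`). If β(H) = 0, every edge is a bridge with a
side free of vertices of degree at least 3. This side is a path, and sliding it one step puts H
inside its own subdivision (`isContained_elementarySubdivision`), so topological minors are
subgraphs. If uv is internal, replace it by a path longer than |H|. A copy of H misses a vertex of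
the path, and breaking the path there leaves pendant paths and fewer than β(H) internal edges
(`internalEdgeCount_rerouted_lt`).

The same count gives hard instances: H without uv, together with M line vertices that either join u
to v (the rest forming a separate path) or form two pendant paths at u and v. Cut the line into
blocks 1 2 3 4. The positive instance u12v, 34 becomes the negative instance u14, 32v by exchanging
two edges for two non-edges. Each instance has about M² such switches on average; O(M) of them
affect a given edge, at most 4 a given non-edge. With cost M^(-1/2) at edges and M^(1/2) at
non-edges, the adversary argument (`adversary_bound`) yields M²/M^(1/2) = M^(3/2) queries up to a
constant (`query_lower_bound`). -/

/-! ### The quantum adversary method -/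

theorem oracle_apply {n w : ℕ} (G : SimpleGraph (Fin n)) (ψ : QState n w) (x : QBasis n w) :
    oracle G w ψ x = ψ (oracleFun G w x) := by
  simp [oracle]

theorem norm_stateAfter {n : ℕ} (A : QueryAlgorithm n) (G : SimpleGraph (Fin n)) (t : ℕ) :
    ‖A.stateAfter G t‖ = 1 := by
  induction t with
  | zero => simp [QueryAlgorithm.stateAfter]
  | succ t ih => simp [QueryAlgorithm.stateAfter, ih]

/-- The probability that a measurement of the query register yields the pair `p`. -/
noncomputable def queryWeight {n w : ℕ} (ψ : QState n w) (p : Fin n × Fin n) : ℝ :=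
  ∑ b : Bool, ∑ z : Fin w, ‖ψ ((p.1, p.2, b), z)‖ ^ 2

theorem sum_qbasis {n w : ℕ} (f : QBasis n w → ℝ) :
    ∑ x, f x = ∑ p : Fin n × Fin n, ∑ b : Bool, ∑ z : Fin w, f ((p.1, p.2, b), z) := by
  simp only [Fintype.sum_prod_type]

theorem sum_queryWeight {n w : ℕ} (ψ : QState n w) : ∑ p, queryWeight ψ p = ‖ψ‖ ^ 2 := by
  rw [EuclideanSpace.norm_sq_eq, sum_qbasis]
  rfl

theorem queryWeight_nonneg {n w : ℕ} (ψ : QState n w) (p : Fin n × Fin n) :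
    0 ≤ queryWeight ψ p := by
  unfold queryWeight
  positivity

/-- Weighted AM-GM: 2|a||b| ≤ c|a|² + d|b|² when cd = 1. The gap to the lower bound
`weighted_le_norm_sub_sq` is 2c|a|² + 2d|b|², the price of one query. -/
theorem norm_sub_sq_le_weighted {a b : ℂ} {c d : ℝ} (hc : 0 < c) (hcd : c * d = 1) :
    ‖a - b‖ ^ 2 ≤ (1 + c) * ‖a‖ ^ 2 + (1 + d) * ‖b‖ ^ 2 := by
  have h : ‖a - b‖ ^ 2 ≤ (‖a‖ + ‖b‖) ^ 2 := by gcongr; exact norm_sub_le a b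
  have h2 : 0 ≤ (c * ‖a‖ - ‖b‖) ^ 2 * d := by
    have : 0 < d := by by_contra hd; nlinarith
    positivity
  have h3 : (c * ‖a‖ - ‖b‖) ^ 2 * d = c * ‖a‖ ^ 2 + d * ‖b‖ ^ 2 - 2 * (‖a‖ * ‖b‖) := by
    linear_combination (c * ‖a‖ ^ 2 - 2 * ‖a‖ * ‖b‖) * hcd
  linarith

theorem weighted_le_norm_sub_sq {a b : ℂ} {c d : ℝ} (hc : 0 < c) (hcd : c * d = 1) :
    (1 - c) * ‖a‖ ^ 2 + (1 - d) * ‖b‖ ^ 2 ≤ ‖a - b‖ ^ 2 := by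
  have h : (‖a‖ - ‖b‖) ^ 2 ≤ ‖a - b‖ ^ 2 := by
    rw [← sq_abs (‖a‖ - ‖b‖)]; gcongr; exact abs_norm_sub_norm_le a b
  have h2 : 0 ≤ (c * ‖a‖ - ‖b‖) ^ 2 * d := by
    have : 0 < d := by by_contra hd; nlinarith
    positivity
  have h3 : (c * ‖a‖ - ‖b‖) ^ 2 * d = c * ‖a‖ ^ 2 + d * ‖b‖ ^ 2 - 2 * (‖a‖ * ‖b‖) := by
    linear_combination (c * ‖a‖ ^ 2 - 2 * ‖a‖ * ‖b‖) * hcd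
  linarith

open Classical in
/-- The cost coefficient of a queried pair: `κ` at an edge and `κ⁻¹` at a non-edge. -/
noncomputable def pairCost {W : Type*} (κ : ℝ) (G : SimpleGraph W) (p : W × W) : ℝ :=
  if G.Adj p.1 p.2 then κ else κ⁻¹

theorem pairCost_pos {W : Type*} {κ : ℝ} (hκ : 0 < κ) (G : SimpleGraph W) (p : W × W) :
    0 < pairCost κ G p := by
  unfold pairCost; split_ifs <;> positivity

open Classical in
-- Where the graphs agree, both oracles permute the amplitudes alike. Where they differ, exactly one
-- has an edge, so the two cost coefficients have product 1 and the weighted bounds apply.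
theorem norm_oracle_sub_sq_le {n w : ℕ} {κ : ℝ} (hκ : 0 < κ) (G G' : SimpleGraph (Fin n))
    (ψ φ : QState n w) :
    ‖oracle G w ψ - oracle G' w φ‖ ^ 2 ≤ ‖ψ - φ‖ ^ 2 +
      2 * ∑ p : Fin n × Fin n, if (G.Adj p.1 p.2 ↔ G'.Adj p.1 p.2) then 0 else
        (pairCost κ G p * queryWeight ψ p + pairCost κ G' p * queryWeight φ p) := by
  rw [EuclideanSpace.norm_sq_eq, EuclideanSpace.norm_sq_eq, sum_qbasis, sum_qbasis, Finset.mul_sum,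
    ← Finset.sum_add_distrib]
  refine Finset.sum_le_sum fun p _ => ?_
  simp only [PiLp.sub_apply, oracle_apply]
  by_cases hp : (G.Adj p.1 p.2 ↔ G'.Adj p.1 p.2)
  · rw [if_pos hp]
    by_cases h : G'.Adj p.1 p.2
    · simp [oracleFun, hp.2 h, h, add_comm]
    · have h2 : ¬ G.Adj p.1 p.2 := fun h' => h (hp.1 h')
      simp [oracleFun, h, h2]
  · rw [if_neg hp]
    have hcd : pairCost κ G p * pairCost κ G' p = 1 := by
      unfold pairCost
      by_cases h : G.Adj p.1 p.2 <;> by_cases h' : G'.Adj p.1 p.2 <;>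
        simp_all [hκ.ne']
    have hc := pairCost_pos hκ G p
    set c := pairCost κ G p
    set d := pairCost κ G' p
    simp only [queryWeight, Fintype.sum_bool, Finset.mul_sum, mul_add, ← Finset.sum_add_distrib]
    refine Finset.sum_le_sum fun z _ => ?_
    -- `h1` bounds the terms after the query, with one answer bit flipped, from above; `h2` bounds
    -- the terms before it from below.
    have h1 : ∀ b : Bool, ‖ψ ((p.1, p.2, b), z) - φ ((p.1, p.2, !b), z)‖ ^ 2 ≤ _ :=
      fun b => norm_sub_sq_le_weighted hc hcd
    have h2 : ∀ b : Bool, _ ≤ ‖ψ ((p.1, p.2, b), z) - φ ((p.1, p.2, b), z)‖ ^ 2 :=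
      fun b => weighted_le_norm_sub_sq hc hcd
    have h1t := h1 true
    have h1f := h1 false
    have h2t := h2 true
    have h2f := h2 false
    by_cases h : G.Adj p.1 p.2 <;> by_cases h' : G'.Adj p.1 p.2
    · exact absurd (by simp [h, h']) hp
    · simp only [oracleFun, h, h', decide_true, decide_false, Bool.xor_true, Bool.xor_false,
        Bool.not_true, Bool.not_false] at h1t h1f ⊢
      linarith
    · simp only [oracleFun, h, h', decide_true, decide_false, Bool.xor_true, Bool.xor_false,
        Bool.not_true, Bool.not_false] at h1t h1f ⊢
      linarith
    · exact absurd (by simp [h, h']) hp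

/-- Summing ‖a‖² ≤ 3/2 ‖b‖² + 3 ‖a - b‖² over accepting outcomes gives 2/3 ≤ 1/2 + 3 ‖ψ - φ‖². -/
theorem one_div_le_norm_stateAfter_sub_sq {n : ℕ} {A : QueryAlgorithm n}
    {P : SimpleGraph (Fin n) → Prop} (hA : A.Decides P) {G G' : SimpleGraph (Fin n)}
    (hG : P G) (hG' : ¬ P G') :
    1 / 18 ≤ ‖A.stateAfter G A.queries - A.stateAfter G' A.queries‖ ^ 2 := by
  have h1 := (hA G).1 hG
  have h2 := (hA G').2 hG'
  unfold QueryAlgorithm.acceptProb at h1 h2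
  set ψ := A.stateAfter G A.queries
  set φ := A.stateAfter G' A.queries
  have h3 : ∑ x ∈ A.accept, ‖ψ x‖ ^ 2 ≤
      ∑ x ∈ A.accept, (3 / 2 * ‖φ x‖ ^ 2 + 3 * ‖(ψ - φ) x‖ ^ 2) := by
    refine Finset.sum_le_sum fun x _ => ?_
    have h : ‖ψ x‖ ≤ ‖φ x‖ + ‖(ψ - φ) x‖ := by
      have := norm_add_le (φ x) ((ψ - φ) x)
      simpa using this
    have h' : ‖ψ x‖ ^ 2 ≤ (‖φ x‖ + ‖(ψ - φ) x‖) ^ 2 := by gcongr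
    nlinarith [sq_nonneg (‖φ x‖ - 2 * ‖(ψ - φ) x‖)]
  rw [Finset.sum_add_distrib, ← Finset.mul_sum, ← Finset.mul_sum] at h3
  have h4 : ∑ x ∈ A.accept, ‖(ψ - φ) x‖ ^ 2 ≤ ‖ψ - φ‖ ^ 2 := by
    rw [EuclideanSpace.norm_sq_eq]
    exact Finset.sum_le_univ_sum_of_nonneg fun x => by positivity
  linarith

open Classical in
-- Grouped by the fibres of `px`, each queried pair carries total coefficient at most B, and the
-- query weights of a unit vector sum to 1.
theorem sum_fiber_cost_le {n : ℕ} {R X : Type*} [Fintype R] [Fintype X] (px : R → X)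
    (GX : X → SimpleGraph (Fin n)) (D : R → Fin n × Fin n → Prop) {κ B : ℝ} {w : X → ℕ}
    (ψ : ∀ x, QState n (w x)) (hψ : ∀ x, ‖ψ x‖ = 1)
    (hX : ∀ x p, pairCost κ (GX x) p * (Finset.univ.filter fun r => px r = x ∧ D r p).card ≤ B) :
    ∑ r, ∑ p, (if D r p then pairCost κ (GX (px r)) p * queryWeight (ψ (px r)) p else 0) ≤
      B * Fintype.card X := by
  calc _ = ∑ x, ∑ r, ∑ p, (if px r = x ∧ D r p then
          pairCost κ (GX x) p * queryWeight (ψ x) p else 0) := by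
        refine Eq.trans (Finset.sum_congr rfl fun r _ => ?_) Finset.sum_comm
        rw [Finset.sum_eq_single (px r)]
        · simp
        · intro x _ hx
          simp [hx.symm]
        · simp
    _ = ∑ x, ∑ p, (pairCost κ (GX x) p * (Finset.univ.filter fun r => px r = x ∧ D r p).card) *
          queryWeight (ψ x) p := by
        refine Finset.sum_congr rfl fun x _ => ?_
        rw [Finset.sum_comm]
        refine Finset.sum_congr rfl fun p _ => ?_
        rw [← Finset.sum_filter, Finset.sum_const, nsmul_eq_mul]
        ring
    _ ≤ ∑ x, ∑ p, B * queryWeight (ψ x) p := by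
        refine Finset.sum_le_sum fun x _ => Finset.sum_le_sum fun p _ => ?_
        exact mul_le_mul_of_nonneg_right (hX x p) (queryWeight_nonneg _ _)
    _ = B * Fintype.card X := by
        simp only [← Finset.mul_sum, sum_queryWeight, hψ]
        simp

open Classical in
/-- The quantum adversary lower bound for a relation `R` between positive inputs `GX (px r)` and
negative inputs `GY (py r)`. -/
theorem adversary_bound {n : ℕ} {R X Y : Type*} [Fintype R] [Fintype X] [Fintype Y]
    {A : QueryAlgorithm n} {P : SimpleGraph (Fin n) → Prop} (hA : A.Decides P)
    (px : R → X) (py : R → Y) (GX : X → SimpleGraph (Fin n)) (GY : Y → SimpleGraph (Fin n))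
    (hpos : ∀ r, P (GX (px r))) (hneg : ∀ r, ¬ P (GY (py r))) {κ B : ℝ} (hκ : 0 < κ)
    (hX : ∀ x p, pairCost κ (GX x) p * (Finset.univ.filter fun r => px r = x ∧
      ¬ ((GX (px r)).Adj p.1 p.2 ↔ (GY (py r)).Adj p.1 p.2)).card ≤ B)
    (hY : ∀ y p, pairCost κ (GY y) p * (Finset.univ.filter fun r => py r = y ∧
      ¬ ((GX (px r)).Adj p.1 p.2 ↔ (GY (py r)).Adj p.1 p.2)).card ≤ B) :
    (Fintype.card R : ℝ) ≤
      36 * B * (Fintype.card X + Fintype.card Y) * A.queries := by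
  obtain ⟨D, hD⟩ : ∃ D : R → Fin n × Fin n → Prop, ∀ r p, D r p ↔
      ¬ ((GX (px r)).Adj p.1 p.2 ↔ (GY (py r)).Adj p.1 p.2) := ⟨_, fun _ _ => Iff.rfl⟩
  simp only [← hD] at hX hY
  -- The potential is the total squared distance over related pairs. It starts at 0, grows by at
  -- most 2B(|X| + |Y|) per query and must end at |R|/18 or more.
  have key : ∀ t : ℕ, ∑ r, ‖A.stateAfter (GX (px r)) t - A.stateAfter (GY (py r)) t‖ ^ 2 ≤
      2 * B * (Fintype.card X + Fintype.card Y) * t := by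
    intro t
    induction t with
    | zero => simp [QueryAlgorithm.stateAfter]
    | succ t ih =>
      have h1 := sum_fiber_cost_le px GX D
        (fun x => A.stateAfter (GX x) t) (κ := κ) (B := B) (fun x => norm_stateAfter A _ t)
        hX
      have h2 := sum_fiber_cost_le py GY D
        (fun x => A.stateAfter (GY x) t) (κ := κ) (B := B) (fun x => norm_stateAfter A _ t)
        hY
      have h3 : ∑ r, ‖A.stateAfter (GX (px r)) (t + 1) - A.stateAfter (GY (py r)) (t + 1)‖ ^ 2 ≤
          ∑ r, ‖A.stateAfter (GX (px r)) t - A.stateAfter (GY (py r)) t‖ ^ 2 + 2 *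
          (∑ r, ∑ p, (if D r p then
            pairCost κ (GX (px r)) p * queryWeight (A.stateAfter (GX (px r)) t) p else 0) +
          ∑ r, ∑ p, (if D r p then
            pairCost κ (GY (py r)) p * queryWeight (A.stateAfter (GY (py r)) t) p else 0)) := by
        rw [← Finset.sum_add_distrib, Finset.mul_sum, ← Finset.sum_add_distrib]
        refine Finset.sum_le_sum fun r _ => ?_
        simp only [QueryAlgorithm.stateAfter, ← map_sub, LinearIsometryEquiv.norm_map]
        refine (norm_oracle_sub_sq_le hκ _ _ _ _).trans (le_of_eq ?_)
        rw [← Finset.sum_add_distrib]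
        congr 2
        refine Finset.sum_congr rfl fun p _ => ?_
        by_cases h : D r p
        · simp [h, (hD r p).1 h]
        · simp [h, not_not.1 (mt (hD r p).2 h)]
      push_cast
      linarith
  have h1 : ∑ _r : R, (1 / 18 : ℝ) ≤ _ :=
    (Finset.sum_le_sum fun r _ => one_div_le_norm_stateAfter_sub_sq hA (hpos r) (hneg r)).trans
      (key A.queries)
  simp only [Finset.sum_const, Finset.card_univ, nsmul_eq_mul] at h1
  linarith

theorem le_quantumQueryComplexity {n : ℕ} {P : SimpleGraph (Fin n) → Prop} {x : ℝ}
    (h : ∀ A : QueryAlgorithm n, A.Decides P → x ≤ A.queries) :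
    ENNReal.ofReal x ≤ (quantumQueryComplexity P : ℝ≥0∞) := by
  have h1 : ((⌈x⌉₊ : ℕ) : ℕ∞) ≤ quantumQueryComplexity P :=
    le_iInf fun A => le_iInf fun hA => by exact_mod_cast Nat.ceil_le.2 (h A hA)
  calc ENNReal.ofReal x ≤ ((⌈x⌉₊ : ℕ) : ℝ≥0∞) := by
        rw [ENNReal.ofReal_le_iff_le_toReal (by simp)]
        simpa using Nat.le_ceil x
    _ = (((⌈x⌉₊ : ℕ) : ℕ∞) : ℝ≥0∞) := by simp
    _ ≤ _ := by exact_mod_cast h1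

/-! ### Internal edges in terms of reachability -/

theorem SimpleGraph.Reachable.lift {V W : Type*} {G : SimpleGraph V} {K : SimpleGraph W}
    (f : V → W) (hf : ∀ x y, G.Adj x y → K.Reachable (f x) (f y)) {x y : V}
    (h : G.Reachable x y) : K.Reachable (f x) (f y) := by
  obtain ⟨p⟩ := h
  induction p with
  | nil => exact SimpleGraph.Reachable.refl _
  | cons h p ih => exact (hf _ _ h).trans ih

theorem SimpleGraph.Reachable.mem_of_closed {V : Type*} {G : SimpleGraph V} (T : Set V)
    (hT : ∀ x y, G.Adj x y → x ∈ T → y ∈ T) {x y : V}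
    (h : G.Reachable x y) (hx : x ∈ T) : y ∈ T := by
  obtain ⟨p⟩ := h
  induction p with
  | nil => exact hx
  | cons h p ih => exact ih (hT _ _ h hx)

/-- `ab` is an edge such that, after its deletion, either `a` and `b` are still connected or each of
them is connected to a vertex that had degree at least 3. -/
def IsInternalPair {V : Type*} (G : SimpleGraph V) (a b : V) : Prop :=
  G.Adj a b ∧ ((G.deleteEdges {s(a, b)}).Reachable a b ∨
    ∃ r s, 3 ≤ (G.neighborSet r).encard ∧ 3 ≤ (G.neighborSet s).encard ∧
      (G.deleteEdges {s(a, b)}).Reachable r a ∧ (G.deleteEdges {s(a, b)}).Reachable s b)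

theorem IsInternalPair.symm {V : Type*} {G : SimpleGraph V} {a b : V}
    (h : IsInternalPair G a b) : IsInternalPair G b a := by
  obtain ⟨h1, h2⟩ := h
  refine ⟨h1.symm, ?_⟩
  rw [Sym2.eq_swap]
  rcases h2 with h2 | ⟨r, s, hr, hs, hra, hsb⟩
  · exact Or.inl h2.symm
  · exact Or.inr ⟨s, r, hs, hr, hsb, hra⟩

theorem reachable_deleteEdges_of_notMem_edges {V : Type*} {G : SimpleGraph V} {e : Sym2 V} {u v : V}
    (p : G.Walk u v) (h : e ∉ p.edges) : (G.deleteEdges {e}).Reachable u v :=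
  ⟨p.toDeleteEdge e h⟩

/-- A trail passes ab only once, so its pieces before and after the passage survive the deletion.
The alternatives are the two directions of passage. -/
theorem reachable_deleteEdges_of_isTrail {V : Type*} {G : SimpleGraph V} {a b u v : V}
    (p : G.Walk u v) (hp : p.IsTrail) (h : s(a, b) ∈ p.edges) :
    ((G.deleteEdges {s(a, b)}).Reachable u a ∧ (G.deleteEdges {s(a, b)}).Reachable v b) ∨
    ((G.deleteEdges {s(a, b)}).Reachable u b ∧ (G.deleteEdges {s(a, b)}).Reachable v a) := by
  induction p with
  | nil => simp at h
  | @cons u w v huw p ih =>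
    rw [SimpleGraph.Walk.isTrail_cons] at hp
    by_cases he : s(a, b) = s(u, w)
    · have hr : (G.deleteEdges {s(a, b)}).Reachable w v :=
        reachable_deleteEdges_of_notMem_edges p (he ▸ hp.2)
      rcases Sym2.eq_iff.1 he with ⟨rfl, rfl⟩ | ⟨rfl, rfl⟩
      · exact Or.inl ⟨SimpleGraph.Reachable.refl _, hr.symm⟩
      · exact Or.inr ⟨SimpleGraph.Reachable.refl _, hr.symm⟩
    · have hadj : (G.deleteEdges {s(a, b)}).Reachable u w := by
        refine SimpleGraph.Adj.reachable ?_
        rw [SimpleGraph.deleteEdges_adj]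
        exact ⟨huw, fun h' => he (Set.mem_singleton_iff.1 h').symm⟩
      rw [SimpleGraph.Walk.edges_cons, List.mem_cons] at h
      rcases ih hp.1 (h.resolve_left he) with h' | h'
      · exact Or.inl ⟨hadj.trans h'.1, h'.2⟩
      · exact Or.inr ⟨hadj.trans h'.1, h'.2⟩

/-- An edge that is not a bridge lies on a cycle. If ab is a bridge, every path from r to s has to
cross it. -/
theorem isInternalPair_iff {V : Type*} {G : SimpleGraph V} {a b : V} :
    IsInternalPair G a b ↔ G.Adj a b ∧ IsInternalEdge G s(a, b) := by
  constructor
  · rintro ⟨hab, h⟩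
    refine ⟨hab, ?_⟩
    by_cases hr : (G.deleteEdges {s(a, b)}).Reachable a b
    · exact Or.inl (SimpleGraph.adj_and_reachable_delete_edges_iff_exists_cycle.1 ⟨hab, hr⟩)
    · obtain ⟨r, s, hr3, hs3, hra, hsb⟩ := h.resolve_left hr
      have hle := G.deleteEdges_le {s(a, b)}
      obtain ⟨p, hp⟩ :=
        (((hra.mono hle).trans hab.reachable).trans (hsb.mono hle).symm).exists_isPath
      refine Or.inr ⟨r, s, p, hr3, hs3, hp, ?_⟩
      by_contra hmem
      exact hr ((hra.symm.trans (reachable_deleteEdges_of_notMem_edges p hmem)).trans hsb)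
  · rintro ⟨hab, h | ⟨u, v, p, hu, hv, hp, hmem⟩⟩
    · exact ⟨hab, Or.inl (SimpleGraph.adj_and_reachable_delete_edges_iff_exists_cycle.2 h).2⟩
    · refine ⟨hab, Or.inr ?_⟩
      rcases reachable_deleteEdges_of_isTrail p hp.isTrail hmem with h | h
      · exact ⟨u, v, hu, hv, h.1, h.2⟩
      · exact ⟨v, u, hv, hu, h.2, h.1⟩

/-- The set of internal edges of a graph. -/
def internalEdges {V : Type*} (G : SimpleGraph V) : Set (Sym2 V) :=
  {e ∈ G.edgeSet | IsInternalEdge G e}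

theorem mk_mem_internalEdges {V : Type*} {G : SimpleGraph V} {a b : V} :
    s(a, b) ∈ internalEdges G ↔ IsInternalPair G a b :=
  isInternalPair_iff.symm

theorem encard_neighborSet_le {V W : Type*} {G : SimpleGraph V} {K : SimpleGraph W} {x : V} {y : W}
    (f : V → W) (hf : Set.InjOn f (G.neighborSet x)) (h : ∀ z, G.Adj x z → K.Adj y (f z)) :
    (G.neighborSet x).encard ≤ (K.neighborSet y).encard :=
  Set.encard_le_encard_of_injOn (fun z hz => h z hz) hf

/-- Injectivity keeps degrees from dropping and other edges from landing on the image of ab. -/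
theorem IsInternalPair.map {V W : Type*} {G : SimpleGraph V} {K : SimpleGraph W} (f : G →g K)
    (hf : Function.Injective f) {a b : V} (h : IsInternalPair G a b) :
    IsInternalPair K (f a) (f b) := by
  have hr : ∀ x y, (G.deleteEdges {s(a, b)}).Reachable x y →
      (K.deleteEdges {s(f a, f b)}).Reachable (f x) (f y) := by
    refine fun x y => SimpleGraph.Reachable.lift f fun x y hxy => SimpleGraph.Adj.reachable ?_
    rw [SimpleGraph.deleteEdges_adj] at hxy ⊢
    refine ⟨f.map_adj hxy.1, fun he => hxy.2 ?_⟩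
    exact Sym2.map.injective hf (by simpa using he)
  have hd : ∀ x, (G.neighborSet x).encard ≤ (K.neighborSet (f x)).encard := fun x =>
    encard_neighborSet_le f hf.injOn fun z hz => f.map_adj hz
  obtain ⟨hab, h⟩ := h
  refine ⟨f.map_adj hab, ?_⟩
  rcases h with h | ⟨r, s, hr3, hs3, hra, hsb⟩
  · exact Or.inl (hr _ _ h)
  · exact Or.inr ⟨f r, f s, hr3.trans (hd r), hs3.trans (hd s), hr _ _ hra, hr _ _ hsb⟩

theorem internalEdgeCount_le_of_injective {V W : Type*} [Finite W] {G : SimpleGraph V}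
    {K : SimpleGraph W} (f : G →g K) (hf : Function.Injective f) :
    internalEdgeCount G ≤ internalEdgeCount K := by
  refine Set.ncard_le_ncard_of_injOn (Sym2.map f) ?_ (Sym2.map.injective hf).injOn (Set.toFinite _)
  intro e
  induction e with
  | h a b => exact fun h => mk_mem_internalEdges.2 ((mk_mem_internalEdges.1 h).map f hf)

theorem internalEdgeCount_le_of_isContained {V W : Type*} [Finite W] {G : SimpleGraph V}
    {K : SimpleGraph W} (h : G.IsContained K) : internalEdgeCount G ≤ internalEdgeCount K := by
  obtain ⟨f⟩ := h
  exact internalEdgeCount_le_of_injective f.toHom f.injective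

/-! ### Internal edges under elementary subdivision -/

section Subdivision

variable {W : Type*} {G : SimpleGraph W} {u v : W}

theorem elementarySubdivision_adj_some {x y : W} :
    (elementarySubdivision G u v).Adj (some x) (some y) ↔ G.Adj x y ∧ s(x, y) ≠ s(u, v) := by
  simp only [elementarySubdivision, SimpleGraph.sup_adj, SimpleGraph.map_adj', SimpleGraph.edge_adj,
    SimpleGraph.deleteEdges_adj]
  constructor
  · rintro ((⟨_, x', y', h, hx, hy⟩ | h) | h)
    · cases hx
      cases hy
      exact h
    all_goals simp at h
  · rintro ⟨h, hne⟩
    exact Or.inl (Or.inl ⟨by simpa using h.ne, x, y, ⟨h, hne⟩, rfl, rfl⟩)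

theorem elementarySubdivision_adj_none {x : W} :
    (elementarySubdivision G u v).Adj (some x) none ↔ x = u ∨ x = v := by
  simp [elementarySubdivision, SimpleGraph.map_adj', SimpleGraph.edge_adj]

theorem elementarySubdivision_not_adj_none_none :
    ¬ (elementarySubdivision G u v).Adj none none := SimpleGraph.irrefl _

theorem encard_neighborSet_le_elementarySubdivision (x : W) :
    (G.neighborSet x).encard ≤ ((elementarySubdivision G u v).neighborSet (some x)).encard := by
  classical
  refine encard_neighborSet_le (fun z => if s(x, z) = s(u, v) then none else some z) ?_ ?_
  · intro z _ z' _ h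
    by_cases h1 : s(x, z) = s(u, v) <;> by_cases h2 : s(x, z') = s(u, v)
    · exact Sym2.congr_right.1 (h1.trans h2.symm)
    all_goals simp_all
  · intro z hz
    by_cases h1 : s(x, z) = s(u, v)
    · rw [if_pos h1, elementarySubdivision_adj_none]
      rcases Sym2.eq_iff.1 h1 with h | h
      · exact Or.inl h.1
      · exact Or.inr h.1
    · rw [if_neg h1, elementarySubdivision_adj_some]
      exact ⟨hz, h1⟩

theorem isInternalPair_elementarySubdivision_none (h : IsInternalPair G u v) :
    IsInternalPair (elementarySubdivision G u v) (some u) none := by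
  have hd := encard_neighborSet_le_elementarySubdivision (G := G) (u := u) (v := v)
  have hr : ∀ x y, (G.deleteEdges {s(u, v)}).Reachable x y →
      ((elementarySubdivision G u v).deleteEdges {s(some u, none)}).Reachable (some x) (some y) := by
    refine fun x y => SimpleGraph.Reachable.lift some fun x y hxy => SimpleGraph.Adj.reachable ?_
    rw [SimpleGraph.deleteEdges_adj] at hxy ⊢
    exact ⟨elementarySubdivision_adj_some.2 hxy, by simp⟩
  have hv : ((elementarySubdivision G u v).deleteEdges {s(some u, none)}).Reachable (some v) none := by
    refine SimpleGraph.Adj.reachable ?_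
    rw [SimpleGraph.deleteEdges_adj]
    exact ⟨elementarySubdivision_adj_none.2 (Or.inr rfl), by simp [h.1.ne']⟩
  obtain ⟨hab, h⟩ := h
  refine ⟨elementarySubdivision_adj_none.2 (Or.inl rfl), ?_⟩
  rcases h with h | ⟨r, s, hr3, hs3, hra, hsb⟩
  · exact Or.inl ((hr _ _ h).trans hv)
  · exact Or.inr ⟨some r, some s, hr3.trans (hd r), hs3.trans (hd s), hr _ _ hra,
      (hr _ _ hsb).trans hv⟩

theorem isInternalPair_elementarySubdivision_some {a b : W}
    (hne : s(a, b) ≠ s(u, v)) (h : IsInternalPair G a b) :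
    IsInternalPair (elementarySubdivision G u v) (some a) (some b) := by
  have hd := encard_neighborSet_le_elementarySubdivision (G := G) (u := u) (v := v)
  have hadj : ∀ x, x = u ∨ x = v →
      ((elementarySubdivision G u v).deleteEdges {s(some a, some b)}).Adj (some x) none := by
    intro x hx
    rw [SimpleGraph.deleteEdges_adj]
    exact ⟨elementarySubdivision_adj_none.2 hx, by simp⟩
  have hr : ∀ x y, (G.deleteEdges {s(a, b)}).Reachable x y →
      ((elementarySubdivision G u v).deleteEdges {s(some a, some b)}).Reachable
        (some x) (some y) := by
    refine fun x y => SimpleGraph.Reachable.lift some fun x y hxy => ?_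
    rw [SimpleGraph.deleteEdges_adj] at hxy
    by_cases he : s(x, y) = s(u, v)
    · have hx : x = u ∨ x = v := by
        rcases Sym2.eq_iff.1 he with h | h
        · exact Or.inl h.1
        · exact Or.inr h.1
      have hy : y = u ∨ y = v := by
        rcases Sym2.eq_iff.1 he with h | h
        · exact Or.inr h.2
        · exact Or.inl h.2
      exact (hadj x hx).reachable.trans (hadj y hy).symm.reachable
    · refine SimpleGraph.Adj.reachable ?_
      rw [SimpleGraph.deleteEdges_adj]
      refine ⟨elementarySubdivision_adj_some.2 ⟨hxy.1, he⟩, fun h' => hxy.2 ?_⟩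
      simpa using h'
  obtain ⟨hab, h⟩ := h
  refine ⟨elementarySubdivision_adj_some.2 ⟨hab, hne⟩, ?_⟩
  rcases h with h | ⟨r, s, hr3, hs3, hra, hsb⟩
  · exact Or.inl (hr _ _ h)
  · exact Or.inr ⟨some r, some s, hr3.trans (hd r), hs3.trans (hd s), hr _ _ hra, hr _ _ hsb⟩

theorem internalEdgeCount_le_elementarySubdivision [Finite W] :
    internalEdgeCount G ≤ internalEdgeCount (elementarySubdivision G u v) := by
  classical
  -- One half of the subdivided edge takes the place of uv.
  refine Set.ncard_le_ncard_of_injOn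
    (fun e => if e = s(u, v) then s(some u, none) else Sym2.map some e) ?_ ?_ (Set.toFinite _)
  · intro e
    induction e with
    | h a b =>
      intro h
      replace h := mk_mem_internalEdges.1 h
      by_cases he : s(a, b) = s(u, v)
      · simp only [he, if_true]
        refine mk_mem_internalEdges.2 (isInternalPair_elementarySubdivision_none ?_)
        rcases Sym2.eq_iff.1 he with ⟨rfl, rfl⟩ | ⟨rfl, rfl⟩
        · exact h
        · exact h.symm
      · simp only [he, if_false]
        exact mk_mem_internalEdges.2 (isInternalPair_elementarySubdivision_some he h)
  · have hnone : ∀ e : Sym2 W, Sym2.map some e ≠ s(some u, none) := by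
      intro e
      induction e with
      | h a b => simp
    intro e _ e' _ h
    by_cases h1 : e = s(u, v) <;> by_cases h2 : e' = s(u, v)
    · rw [h1, h2]
    · simp only [h1, h2, if_true, if_false] at h
      exact absurd h.symm (hnone e')
    · simp only [h1, h2, if_true, if_false] at h
      exact absurd h (hnone e)
    · simp only [h1, h2, if_false] at h
      exact Sym2.map.injective (Option.some_injective _) h

end Subdivision

/-- Finiteness is carried through the induction because `Set.ncard` is 0 on infinite sets. -/
theorem IsTopologicalMinor.finite_and_internalEdgeCount_le {V : Type*} [Finite V]
    {H : SimpleGraph V} {W : Type} {G : SimpleGraph W} (h : IsTopologicalMinor H G) :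
    Finite W ∧ internalEdgeCount H ≤ internalEdgeCount G := by
  induction h with
  | self e =>
    have := Finite.of_equiv _ e.toEquiv
    exact ⟨this, internalEdgeCount_le_of_injective e.toHom e.injective⟩
  | iso _ e ih =>
    have := ih.1
    have := Finite.of_equiv _ e.toEquiv
    exact ⟨this, ih.2.trans (internalEdgeCount_le_of_injective e.toHom e.injective)⟩
  | addEdges _ hle ih =>
    have := ih.1
    exact ⟨this, ih.2.trans (internalEdgeCount_le_of_injective (SimpleGraph.Hom.ofLE hle)
      Function.injective_id)⟩
  | @addVertex W G _ ih =>
    have := ih.1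
    exact ⟨inferInstance, ih.2.trans (internalEdgeCount_le_of_injective
      (SimpleGraph.Embedding.map Function.Embedding.some G).toHom (Option.some_injective _))⟩
  | subdivide _ _ ih =>
    have := ih.1
    exact ⟨inferInstance, ih.2.trans internalEdgeCount_le_elementarySubdivision⟩

/-! ### Graphs without internal edges -/

theorem three_le_encard_neighborSet {V : Type*} {G : SimpleGraph V} {x a b c : V}
    (ha : G.Adj x a) (hb : G.Adj x b) (hc : G.Adj x c) (hab : a ≠ b) (hac : a ≠ c) (hbc : b ≠ c) :
    3 ≤ (G.neighborSet x).encard := by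
  have h : ({a, b, c} : Set V) ⊆ G.neighborSet x := by
    rintro y (rfl | rfl | rfl) <;> assumption
  refine le_trans (le_of_eq ?_) (Set.encard_le_encard h)
  exact (Set.encard_eq_three.2 ⟨a, b, c, hab, hac, hbc, rfl⟩).symm

section Shift

variable {V : Type*} {G : SimpleGraph V} {u v : V}

theorem exists_pred_of_dist_eq_succ {K : SimpleGraph V} {k : ℕ} {x : V} (hx : K.Reachable v x)
    (hk : K.dist v x = k + 1) : ∃ y, K.Reachable v y ∧ K.Adj y x ∧ K.dist v y = k := by
  obtain ⟨p, hp⟩ := hx.symm.exists_walk_length_eq_dist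
  rw [SimpleGraph.dist_comm, hk] at hp
  cases p with
  | nil => simp at hp
  | @cons _ y _ h q =>
    refine ⟨y, ⟨q.reverse⟩, h.symm, ?_⟩
    have h1 := SimpleGraph.dist_le q.reverse
    obtain ⟨q', hq'⟩ := (show K.Reachable v y from ⟨q.reverse⟩).exists_walk_length_eq_dist
    have h2 := SimpleGraph.dist_le (q'.concat h.symm)
    simp at h1 h2 hp
    omega

/-- If all vertices on the `v`-side of a bridge `uv` have degree at most 2, then this side is a path
starting at `v`: the distances from `v` are distinct. -/
theorem dist_injOn_of_degree_le_two (huv : G.Adj u v)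
    (hu : ¬ (G.deleteEdges {s(u, v)}).Reachable v u)
    (hdeg : ∀ x, (G.deleteEdges {s(u, v)}).Reachable v x → ¬ 3 ≤ (G.neighborSet x).encard) :
    ∀ x y, (G.deleteEdges {s(u, v)}).Reachable v x → (G.deleteEdges {s(u, v)}).Reachable v y →
      (G.deleteEdges {s(u, v)}).dist v x = (G.deleteEdges {s(u, v)}).dist v y → x = y := by
  set K := G.deleteEdges {s(u, v)} with hK
  have hKG : K ≤ G := G.deleteEdges_le _
  have main : ∀ (k : ℕ) (x y : V), K.Reachable v x → K.Reachable v y → K.dist v x = k →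
      K.dist v y = k → x = y := by
    intro k
    induction k using Nat.strong_induction_on with
    | _ k ih =>
      intro x y hx hy hxk hyk
      cases k with
      | zero => exact (hx.dist_eq_zero_iff.1 hxk).symm.trans (hy.dist_eq_zero_iff.1 hyk)
      | succ k =>
        -- The predecessors of x and y coincide by induction. If x ≠ y, this common vertex has a
        -- third neighbour: u if it is v, its own predecessor otherwise.
        obtain ⟨x', hx', hxx', hxk'⟩ := exists_pred_of_dist_eq_succ hx hxk
        obtain ⟨y', hy', hyy', hyk'⟩ := exists_pred_of_dist_eq_succ hy hyk
        obtain rfl := ih k (Nat.lt_succ_self k) x' y' hx' hy' hxk' hyk'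
        by_contra hne
        cases k with
        | zero =>
          obtain rfl := hx'.dist_eq_zero_iff.1 hxk'
          refine hdeg v hx' (three_le_encard_neighborSet (hKG hxx') (hKG hyy') huv.symm hne ?_ ?_)
          · rintro rfl; exact hu hx
          · rintro rfl; exact hu hy
        | succ k =>
          obtain ⟨z, hz, hzx, hzk⟩ := exists_pred_of_dist_eq_succ hx' hxk'
          refine hdeg x' hx' (three_le_encard_neighborSet (hKG hxx') (hKG hyy') (hKG hzx.symm)
            hne ?_ ?_)
          · rintro rfl; omega
          · rintro rfl; omega
  exact fun x y hx hy h => main _ x y hx hy h rfl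

/-- The path on the v-side is shifted by one towards u: v goes to the new vertex, every other vertex
of the side to its predecessor, and the rest stays. -/
theorem isContained_elementarySubdivision_of_bridge (huv : G.Adj u v)
    (hu : ¬ (G.deleteEdges {s(u, v)}).Reachable v u)
    (hdeg : ∀ x, (G.deleteEdges {s(u, v)}).Reachable v x → ¬ 3 ≤ (G.neighborSet x).encard) :
    G.IsContained (elementarySubdivision G u v) := by
  classical
  have hinj := dist_injOn_of_degree_le_two huv hu hdeg
  set K := G.deleteEdges {s(u, v)} with hK
  have hKG : K ≤ G := G.deleteEdges_le _
  have hadjK : ∀ x y, K.Adj x y ↔ G.Adj x y ∧ s(x, y) ≠ s(u, v) := fun x y => by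
    simp only [hK, SimpleGraph.deleteEdges_adj, Set.mem_singleton_iff, ne_eq]
  have hpred : ∀ x, ∃ y, K.Reachable v x → x ≠ v →
      K.Reachable v y ∧ K.Adj y x ∧ K.dist v y + 1 = K.dist v x := by
    intro x
    by_cases hx : K.Reachable v x ∧ x ≠ v
    · have := hx.1.pos_dist_of_ne hx.2.symm
      obtain ⟨y, h1, h2, h3⟩ := exists_pred_of_dist_eq_succ hx.1
        (show K.dist v x = (K.dist v x - 1) + 1 by omega)
      exact ⟨y, fun _ _ => ⟨h1, h2, by omega⟩⟩
    · exact ⟨x, fun h1 h2 => absurd ⟨h1, h2⟩ hx⟩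
  choose g hg using hpred
  set f : V → Option V := fun x => if K.Reachable v x then (if x = v then none else some (g x))
    else some x with hf
  have hfv : f v = none := by simp [hf]
  have hf1 : ∀ x, K.Reachable v x → x ≠ v → f x = some (g x) := fun x h1 h2 => by simp [hf, h1, h2]
  have hf2 : ∀ x, ¬ K.Reachable v x → f x = some x := fun x h1 => by simp [hf, h1]
  have hstep : ∀ x y, K.Reachable v x → K.Reachable v y → K.Adj x y → K.dist v x < K.dist v y →
      (elementarySubdivision G u v).Adj (f x) (f y) := by
    intro x y hx hy hxy hlt
    have hyv : y ≠ v := by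
      rintro rfl
      simp at hlt
    obtain ⟨hgy, hgadj, hgd⟩ := hg y hy hyv
    have hd := hxy.diff_dist_adj (u := v)
    obtain rfl : g y = x := hinj _ _ hgy hx (by omega)
    rw [hf1 y hy hyv]
    by_cases hxv : g y = v
    · rw [hxv, hfv]
      exact (elementarySubdivision_adj_none.2 (Or.inr rfl)).symm
    · rw [hf1 _ hgy hxv, elementarySubdivision_adj_some, ← hadjK]
      exact (hg _ hgy hxv).2.1
  have hcross : ∀ x y, ¬ K.Reachable v x → K.Reachable v y → G.Adj x y → x = u ∧ y = v := by
    intro x y hx hy hxy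
    by_cases he : s(x, y) = s(u, v)
    · rcases Sym2.eq_iff.1 he with h | h
      · exact h
      · exact absurd (h.1 ▸ SimpleGraph.Reachable.refl _) hx
    · exact absurd (hy.trans ((hadjK x y).2 ⟨hxy, he⟩).symm.reachable) hx
  have hhom : ∀ x y, G.Adj x y → (elementarySubdivision G u v).Adj (f x) (f y) := by
    intro x y hxy
    by_cases hx : K.Reachable v x <;> by_cases hy : K.Reachable v y
    · have hK' : K.Adj x y := by
        refine (hadjK x y).2 ⟨hxy, fun he => ?_⟩
        rcases Sym2.eq_iff.1 he with h | h
        · exact hu (h.1 ▸ hx)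
        · exact hu (h.2 ▸ hy)
      rcases lt_trichotomy (K.dist v x) (K.dist v y) with h | h | h
      · exact hstep x y hx hy hK' h
      · exact absurd (hinj x y hx hy h) hxy.ne
      · exact (hstep y x hy hx hK'.symm h).symm
    · obtain ⟨rfl, rfl⟩ := hcross y x hy hx hxy.symm
      rw [hfv, hf2 _ hy]
      exact (elementarySubdivision_adj_none.2 (Or.inl rfl)).symm
    · obtain ⟨rfl, rfl⟩ := hcross x y hx hy hxy
      rw [hfv, hf2 _ hx]
      exact elementarySubdivision_adj_none.2 (Or.inl rfl)
    · rw [hf2 _ hx, hf2 _ hy, elementarySubdivision_adj_some]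
      refine ⟨hxy, fun he => ?_⟩
      rcases Sym2.eq_iff.1 he with h | h
      · exact hy (h.2 ▸ SimpleGraph.Reachable.refl _)
      · exact hx (h.1 ▸ SimpleGraph.Reachable.refl _)
  refine ⟨⟨⟨f, fun h => hhom _ _ h⟩, ?_⟩⟩
  intro x y hxy
  change f x = f y at hxy
  have hv : ∀ x, f x = none → x = v := by
    intro x h
    by_contra hxv
    by_cases hx : K.Reachable v x
    · simp [hf1 x hx hxv] at h
    · simp [hf2 x hx] at h
  by_cases hxv : x = v
  · rw [hxv, hfv] at hxy
    rw [hxv, hv y hxy.symm]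
  by_cases hyv : y = v
  · rw [hyv, hfv] at hxy
    exact absurd (hv x hxy) hxv
  by_cases hx : K.Reachable v x <;> by_cases hy : K.Reachable v y
  · rw [hf1 x hx hxv, hf1 y hy hyv, Option.some_inj] at hxy
    have h1 := hg x hx hxv
    have h2 := hg y hy hyv
    rw [hxy] at h1
    exact hinj x y hx hy (by omega)
  · rw [hf1 x hx hxv, hf2 y hy, Option.some_inj] at hxy
    exact absurd (hxy ▸ (hg x hx hxv).1) hy
  · rw [hf2 x hx, hf1 y hy hyv, Option.some_inj] at hxy
    exact absurd (hxy ▸ (hg y hy hyv).1) hx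
  · rw [hf2 x hx, hf2 y hy, Option.some_inj] at hxy
    exact hxy

theorem elementarySubdivision_comm (G : SimpleGraph V) (u v : V) :
    elementarySubdivision G u v = elementarySubdivision G v u := by
  unfold elementarySubdivision
  rw [Sym2.eq_swap, SimpleGraph.edge_comm none, SimpleGraph.edge_comm none, sup_right_comm]

/-- A non-internal edge is a bridge, and one of its sides has no vertex of degree at least 3; this
side can be shifted. -/
theorem isContained_elementarySubdivision [Finite V] (h0 : internalEdgeCount G = 0)
    (huv : G.Adj u v) : G.IsContained (elementarySubdivision G u v) := by
  have hno : ¬ IsInternalPair G u v := by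
    intro h
    have h1 : internalEdges G = ∅ := (Set.ncard_eq_zero (Set.toFinite _)).1 h0
    exact Set.notMem_empty _ (h1 ▸ mk_mem_internalEdges.2 h)
  simp only [IsInternalPair, huv, true_and, not_or, not_exists, not_and] at hno
  obtain ⟨h1, h2⟩ := hno
  by_cases h3 : ∀ x, (G.deleteEdges {s(u, v)}).Reachable v x → ¬ 3 ≤ (G.neighborSet x).encard
  · exact isContained_elementarySubdivision_of_bridge huv (fun h => h1 h.symm) h3
  · push Not at h3
    obtain ⟨s, hs, hs3⟩ := h3
    rw [elementarySubdivision_comm]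
    refine isContained_elementarySubdivision_of_bridge huv.symm ?_ ?_
    · rwa [Sym2.eq_swap]
    · intro r hr hr3
      rw [Sym2.eq_swap] at hr
      exact h2 r s hr3 hs3 hr.symm hs.symm

end Shift

theorem IsContained.elementarySubdivision {V W : Type*} [Finite V] {H : SimpleGraph V}
    {G : SimpleGraph W} (h0 : internalEdgeCount H = 0) (h : H.IsContained G) (u v : W) :
    H.IsContained (elementarySubdivision G u v) := by
  obtain ⟨f⟩ := h
  have hf := f.injective
  by_cases huv : ∃ a b, H.Adj a b ∧ s(f a, f b) = s(u, v)
  · obtain ⟨a, b, hab, he⟩ := huv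
    have h1 : H.IsContained (_root_.elementarySubdivision G (f a) (f b)) := by
      refine (isContained_elementarySubdivision h0 hab).trans
        ⟨⟨⟨Option.map f, ?_⟩, Option.map_injective hf⟩⟩
      rintro (_ | x) (_ | y) hxy
      · exact absurd hxy elementarySubdivision_not_adj_none_none
      · refine SimpleGraph.Adj.symm (elementarySubdivision_adj_none.2 ?_)
        exact (elementarySubdivision_adj_none.1 hxy.symm).imp (congrArg f) (congrArg f)
      · refine elementarySubdivision_adj_none.2 ?_
        exact (elementarySubdivision_adj_none.1 hxy).imp (congrArg f) (congrArg f)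
      · rw [elementarySubdivision_adj_some] at hxy
        refine elementarySubdivision_adj_some.2 ⟨f.toHom.map_adj hxy.1, fun h => hxy.2 ?_⟩
        exact Sym2.map.injective hf (by simpa using h)
    rcases Sym2.eq_iff.1 he with ⟨h2, h3⟩ | ⟨h2, h3⟩
    · rwa [h2, h3] at h1
    · rwa [h2, h3, elementarySubdivision_comm] at h1
  · refine ⟨⟨⟨fun x => some (f x), ?_⟩, fun x y h => hf (Option.some_injective _ h)⟩⟩
    intro x y hxy
    exact elementarySubdivision_adj_some.2 ⟨f.toHom.map_adj hxy, fun h => huv ⟨x, y, hxy, h⟩⟩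

theorem IsTopologicalMinor.isContained {V : Type*} [Finite V] {H : SimpleGraph V}
    (h0 : internalEdgeCount H = 0) {W : Type} {G : SimpleGraph W} (h : IsTopologicalMinor H G) :
    H.IsContained G := by
  induction h with
  | self e => exact e.isContained
  | iso _ e ih => exact ih.trans e.isContained
  | addEdges _ hle ih => exact ih.trans (SimpleGraph.IsContained.of_le hle)
  | @addVertex W G _ ih =>
    exact ih.trans (SimpleGraph.Embedding.map Function.Embedding.some G).isContained
  | subdivide _ _ ih => exact IsContained.elementarySubdivision h0 ih _ _

/-! ### Topological minors from subgraphs and from long paths -/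

/-- Each of the k vertices outside the copy is supplied as an isolated vertex; once the copy is
spanning, only edges are missing. -/
theorem IsTopologicalMinor.of_isContained_of_card {V : Type*} {H : SimpleGraph V} (k : ℕ) :
    ∀ {W W' : Type} [Finite W'] {G : SimpleGraph W} {G' : SimpleGraph W'},
      Nat.card W' = Nat.card W + k → IsTopologicalMinor H G → G.IsContained G' →
      IsTopologicalMinor H G' := by
  induction k with
  | zero =>
    intro W W' _ G G' hcard hG ⟨f⟩
    have hbij : Function.Bijective f := f.injective.bijective_of_nat_card_le (by omega)
    let e : W ≃ W' := Equiv.ofBijective f hbij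
    refine .addEdges (.iso hG (SimpleGraph.Iso.map e G)) ?_
    intro x y hxy
    rw [SimpleGraph.map_adj'] at hxy
    obtain ⟨_, a, b, hab, rfl, rfl⟩ := hxy
    exact f.toHom.map_adj hab
  | succ k ih =>
    intro W W' _ G G' hcard hG ⟨f⟩
    have := Finite.of_injective _ f.injective
    have hsurj : ∃ w', ∀ x, f x ≠ w' := by
      by_contra! h
      have := Nat.card_le_card_of_surjective f h
      omega
    obtain ⟨w', hw'⟩ := hsurj
    refine ih (W := Option W) (G := addIsolatedVertex G) ?_ (.addVertex hG)
      ⟨⟨⟨fun x => x.elim w' f, ?_⟩, ?_⟩⟩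
    · rw [Finite.card_option]
      omega
    · intro x y hxy
      rw [addIsolatedVertex, SimpleGraph.map_adj'] at hxy
      obtain ⟨_, a, b, hab, rfl, rfl⟩ := hxy
      exact f.toHom.map_adj hab
    · rintro (_ | x) (_ | y) h
      · rfl
      · exact absurd h.symm (hw' y)
      · exact absurd h (hw' x)
      · exact congrArg some (f.injective h)

theorem IsTopologicalMinor.of_isContained {V : Type*} {H : SimpleGraph V} {W W' : Type} [Finite W']
    {G : SimpleGraph W} {G' : SimpleGraph W'} (h : IsTopologicalMinor H G) (hG : G.IsContained G') :
    IsTopologicalMinor H G' := by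
  obtain ⟨f⟩ := id hG
  have := Finite.of_injective _ f.injective
  have := Nat.card_le_card_of_injective f f.injective
  exact of_isContained_of_card (Nat.card W' - Nat.card W) (by omega) h hG

/-- A graph in which the edge `uv` of `H` is replaced by a path `g 0, g 1, …, g b, f v`, where
`g 0 = f u`, contains `H` as a topological minor. -/
theorem IsTopologicalMinor.of_path {V : Type} {H : SimpleGraph V} {u v : V} (huv : H.Adj u v)
    {W : Type} [Finite W] {G : SimpleGraph W} {f : V → W} (hf : Function.Injective f) {b : ℕ}
    {g : ℕ → W} (hfadj : ∀ x y, H.Adj x y → s(x, y) ≠ s(u, v) → G.Adj (f x) (f y))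
    (hg0 : g 0 = f u) (hgf : ∀ i, 0 < i → i ≤ b → ∀ x, g i ≠ f x)
    (hginj : ∀ i j, 0 < i → i < j → j ≤ b → g i ≠ g j)
    (hgadj : ∀ i, i < b → G.Adj (g i) (g (i + 1))) (hgv : G.Adj (g b) (f v)) :
    IsTopologicalMinor H G := by
  -- K is H after t subdivisions. Its edge pq lies over `g t`, `f v`, which need not be adjacent in
  -- G; all its other edges are mapped to edges. The next subdivision is made at pq.
  have key : ∀ t, t ≤ b → ∃ (W' : Type) (K : SimpleGraph W') (F : W' → W) (p q : W'),
      IsTopologicalMinor H K ∧ Function.Injective F ∧ K.Adj p q ∧ F p = g t ∧ F q = f v ∧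
      (∀ x y, K.Adj x y → s(x, y) ≠ s(p, q) → G.Adj (F x) (F y)) ∧
      (∀ x, (∃ z, F x = f z) ∨ ∃ i, 0 < i ∧ i ≤ t ∧ F x = g i) := by
    intro t
    induction t with
    | zero =>
      exact fun _ => ⟨V, H, f, u, v, .self .refl, hf, huv, hg0.symm, rfl, hfadj,
        fun x => Or.inl ⟨x, rfl⟩⟩
    | succ t ih =>
      intro ht
      obtain ⟨W', K, F, p, q, hK, hF, hpq, hFp, hFq, hFadj, hran⟩ := ih (by omega)
      have hnew : ∀ x, g (t + 1) ≠ F x := by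
        intro x h
        rcases hran x with ⟨z, hz⟩ | ⟨i, hi0, hit, hi⟩
        · exact hgf (t + 1) (by omega) ht z (h.trans hz)
        · exact hginj i (t + 1) hi0 (by omega) ht (hi.symm.trans h.symm)
      refine ⟨Option W', elementarySubdivision K p q, fun x => x.elim (g (t + 1)) F, none, some q,
        .subdivide hK hpq, ?_, (elementarySubdivision_adj_none.2 (Or.inr rfl)).symm, rfl, hFq,
        ?_, ?_⟩
      · rintro (_ | x) (_ | y) h
        · rfl
        · exact absurd h (hnew y)
        · exact absurd h.symm (hnew x)
        · exact congrArg some (hF h)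
      · have hnone : ∀ x, (elementarySubdivision K p q).Adj (some x) none → x ≠ q →
            G.Adj (F x) (g (t + 1)) := by
          intro x hx hxq
          obtain rfl := (elementarySubdivision_adj_none.1 hx).resolve_right hxq
          rw [hFp]
          exact hgadj t (by omega)
        rintro (_ | x) (_ | y) hxy hne
        · exact absurd hxy elementarySubdivision_not_adj_none_none
        · exact (hnone y hxy.symm (by rintro rfl; exact hne rfl)).symm
        · exact hnone x hxy (by rintro rfl; exact hne Sym2.eq_swap)
        · rw [elementarySubdivision_adj_some] at hxy
          exact hFadj x y hxy.1 hxy.2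
      · rintro (_ | x)
        · exact Or.inr ⟨t + 1, by omega, le_rfl, rfl⟩
        · rcases hran x with h | ⟨i, hi0, hit, hi⟩
          · exact Or.inl h
          · exact Or.inr ⟨i, hi0, by omega, hi⟩
  obtain ⟨W', K, F, p, q, hK, hF, hpq, hFp, hFq, hFadj, -⟩ := key b le_rfl
  refine hK.of_isContained ⟨⟨⟨F, ?_⟩, hF⟩⟩
  intro x y hxy
  by_cases h : s(x, y) = s(p, q)
  · rw [← hFp, ← hFq] at hgv
    rcases Sym2.eq_iff.1 h with ⟨rfl, rfl⟩ | ⟨rfl, rfl⟩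
    · exact hgv
    · exact hgv.symm
  · exact hFadj x y hxy h

/-! ### The hard instances -/

/-- The adjacency relation of `rerouted`. -/
def reroutedAdj {V : Type*} (H : SimpleGraph V) (u v : V) {M : ℕ} (π : Fin M → ℕ) (c d : ℕ) :
    V ⊕ Fin M → V ⊕ Fin M → Prop
  | .inl x, .inl y => H.Adj x y ∧ s(x, y) ≠ s(u, v)
  | .inl x, .inr i => (x = u ∧ π i = 0) ∨ (x = v ∧ π i + 1 = d)
  | .inr i, .inl x => (x = u ∧ π i = 0) ∨ (x = v ∧ π i + 1 = d)
  | .inr i, .inr j => (π j = π i + 1 ∧ π j ≠ c) ∨ (π i = π j + 1 ∧ π i ≠ c)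

/-- The edge `uv` of `H` is deleted and new vertices, the position of `i` being `π i`, are arranged
on a line that is cut in front of the position `c`; the vertex `u` is attached to the vertex at the
position `0`, the vertex `v` to the last vertex in front of the position `d`. -/
def rerouted {V : Type*} (H : SimpleGraph V) (u v : V) {M : ℕ} (π : Fin M → ℕ) (c d : ℕ) :
    SimpleGraph (V ⊕ Fin M) where
  Adj := reroutedAdj H u v π c d
  symm := ⟨by
    rintro (x | i) (y | j) h
    · exact ⟨h.1.symm, fun h' => h.2 (Sym2.eq_swap.trans h')⟩
    · exact h
    · exact h
    · exact h.symm⟩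
  loopless := ⟨by
    rintro (x | i) h
    · exact H.irrefl h.1
    · rcases h with h | h <;> omega⟩

section Rerouted

variable {V : Type*} {H : SimpleGraph V} {u v : V} {M : ℕ} {π : Fin M → ℕ} {c d : ℕ}

theorem rerouted_adj_inl_inl {x y : V} :
    (rerouted H u v π c d).Adj (.inl x) (.inl y) ↔ H.Adj x y ∧ s(x, y) ≠ s(u, v) := Iff.rfl

theorem rerouted_adj_inl_inr {x : V} {i : Fin M} : (rerouted H u v π c d).Adj (.inl x) (.inr i) ↔
    (x = u ∧ π i = 0) ∨ (x = v ∧ π i + 1 = d) := Iff.rfl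

theorem rerouted_adj_inr_inl {x : V} {i : Fin M} : (rerouted H u v π c d).Adj (.inr i) (.inl x) ↔
    (x = u ∧ π i = 0) ∨ (x = v ∧ π i + 1 = d) := Iff.rfl

theorem rerouted_adj_inr_inr {i j : Fin M} : (rerouted H u v π c d).Adj (.inr i) (.inr j) ↔
    (π j = π i + 1 ∧ π j ≠ c) ∨ (π i = π j + 1 ∧ π i ≠ c) := Iff.rfl

/-- The new neighbour of u stands in for v, and that of v for u. -/
theorem encard_neighborSet_rerouted_inl (hπ : Function.Injective π) (x : V) (huv : H.Adj u v) :
    ((rerouted H u v π c d).neighborSet (.inl x)).encard ≤ (H.neighborSet x).encard := by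
  classical
  have hne := huv.ne
  refine encard_neighborSet_le (Sum.elim id fun _ => if x = u then v else u) ?_ ?_
  · rintro (y | i) h (z | j) h' heq <;> rw [SimpleGraph.mem_neighborSet] at h h'
    · exact congrArg Sum.inl heq
    · have h1 := rerouted_adj_inl_inl.1 h
      have h2 := rerouted_adj_inl_inr.1 h'
      simp only [Sum.elim_inl, Sum.elim_inr, id] at heq
      split_ifs at heq with hx
      · exact absurd (by rw [hx, heq]) h1.2
      · obtain rfl := (h2.resolve_left fun h => hx h.1).1
        exact absurd (by rw [heq, Sym2.eq_swap]) h1.2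
    · have h1 := rerouted_adj_inl_inl.1 h'
      have h2 := rerouted_adj_inl_inr.1 h
      simp only [Sum.elim_inl, Sum.elim_inr, id] at heq
      split_ifs at heq with hx
      · exact absurd (by rw [hx, ← heq]) h1.2
      · obtain rfl := (h2.resolve_left fun h => hx h.1).1
        exact absurd (by rw [← heq, Sym2.eq_swap]) h1.2
    · have h1 := rerouted_adj_inl_inr.1 h
      have h2 := rerouted_adj_inl_inr.1 h'
      refine congrArg Sum.inr (hπ ?_)
      by_cases hx : x = u
      · subst hx
        simp only [hne, false_and, or_false, true_and] at h1 h2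
        omega
      · simp only [hx, false_and, false_or] at h1 h2
        omega
  · rintro (y | i) h
    · exact h.1
    · rcases rerouted_adj_inl_inr.1 h with h | h
      · simp only [Sum.elim_inr, h.1, if_true]
        exact huv
      · simp only [Sum.elim_inr, h.1, hne.symm, if_false]
        exact huv.symm

theorem encard_neighborSet_rerouted_inr (hπ : Function.Injective π) (hπM : ∀ i, π i < M)
    (huv : H.Adj u v) (i : Fin M) :
    ¬ 3 ≤ ((rerouted H u v π c M).neighborSet (.inr i)).encard := by
  classical
  have hne := huv.ne
  have h1 : ((rerouted H u v π c M).neighborSet (.inr i)).encard ≤ (Set.univ : Set Bool).encard := by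
    -- `true` marks v and the next line vertex, `false` marks u and the previous one. Since u sits
    -- at position 0 and v at position M - 1, no mark occurs twice.
    refine Set.encard_le_encard_of_injOn
      (f := Sum.elim (fun x => decide (x = v)) fun j => decide (π j = π i + 1))
      (fun _ _ => Set.mem_univ _) ?_
    have hmix : ∀ (x : V) (j : Fin M), (rerouted H u v π c M).Adj (.inr i) (.inl x) →
        (rerouted H u v π c M).Adj (.inr i) (.inr j) →
        decide (x = v) ≠ decide (π j = π i + 1) := by
      intro x j hx hj heq
      rw [rerouted_adj_inr_inl] at hx
      rw [rerouted_adj_inr_inr] at hj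
      rw [decide_eq_decide] at heq
      have := hπM j
      rcases hx with ⟨rfl, h0⟩ | ⟨rfl, h0⟩
      · have := mt heq.2 hne
        omega
      · have := heq.1 rfl
        omega
    rintro (x | j) hx (y | k) hy heq <;> rw [SimpleGraph.mem_neighborSet] at hx hy
    · simp only [Sum.elim_inl, decide_eq_decide] at heq
      refine congrArg Sum.inl ?_
      rcases rerouted_adj_inr_inl.1 hx with h | h
      · rcases rerouted_adj_inr_inl.1 hy with h' | h'
        · rw [h.1, h'.1]
        · rw [h'.1, heq.2 h'.1]
      · rw [h.1, heq.1 h.1]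
    · exact absurd heq (hmix x k hx hy)
    · exact absurd heq.symm (hmix y j hy hx)
    · simp only [Sum.elim_inr, decide_eq_decide] at heq
      have h1 := rerouted_adj_inr_inr.1 hx
      have h2 := rerouted_adj_inr_inr.1 hy
      refine congrArg Sum.inr (hπ ?_)
      omega
  refine fun h => absurd (h.trans h1) ?_
  rw [Set.encard_univ, ENat.card_eq_coe_fintype_card, Fintype.card_bool]
  exact_mod_cast (by omega : ¬ 3 ≤ 2)

/-- Without pq, nothing outside T is reachable from p: neither q nor a vertex of degree at least 3.
-/
theorem not_isInternalPair_of_closed {W : Type*} {G : SimpleGraph W} {p q : W} (T : Set W)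
    (hp : p ∈ T) (hq : q ∉ T) (hdeg : ∀ x ∈ T, ¬ 3 ≤ (G.neighborSet x).encard)
    (hT : ∀ x y, G.Adj x y → x ∈ T → y ∉ T → s(x, y) = s(p, q)) : ¬ IsInternalPair G p q := by
  have hcl : ∀ x y, (G.deleteEdges {s(p, q)}).Adj x y → x ∈ T → y ∈ T := by
    intro x y hxy hx
    rw [SimpleGraph.deleteEdges_adj] at hxy
    by_contra hy
    exact hxy.2 (hT x y hxy.1 hx hy)
  rintro ⟨-, h | ⟨r, s, hr3, -, hrp, -⟩⟩
  · exact hq (h.mem_of_closed T hcl hp)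
  · exact hdeg r (hrp.symm.mem_of_closed T hcl hp) hr3

/-- T is the whole pendant path on one side of the cut. -/
theorem not_isInternalPair_rerouted_inr_inl (hπ : Function.Injective π) (hπM : ∀ i, π i < M)
    (huv : H.Adj u v) (hc0 : 0 < c) (hcM : c < M) (i : Fin M) (x : V) :
    ¬ IsInternalPair (rerouted H u v π c M) (.inr i) (.inl x) := by
  intro h
  have hne := huv.ne
  rcases rerouted_adj_inr_inl.1 h.1 with ⟨rfl, h0⟩ | ⟨rfl, h0⟩
  · refine not_isInternalPair_of_closed {z | ∃ k, z = .inr k ∧ π k < c} ⟨i, rfl, by omega⟩ (by simp)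
      ?_ ?_ h
    · rintro _ ⟨k, rfl, -⟩
      exact encard_neighborSet_rerouted_inr hπ hπM huv k
    · rintro _ (y | j) hadj ⟨k, rfl, hk⟩ hj
      · rw [rerouted_adj_inr_inl] at hadj
        rcases hadj with ⟨rfl, h1⟩ | ⟨rfl, h1⟩
        · rw [hπ (h1.trans h0.symm)]
        · omega
      · rw [rerouted_adj_inr_inr] at hadj
        have : ¬ π j < c := fun h => hj ⟨j, rfl, h⟩
        omega
  · refine not_isInternalPair_of_closed {z | ∃ k, z = .inr k ∧ c ≤ π k} ⟨i, rfl, by omega⟩ (by simp)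
      ?_ ?_ h
    · rintro _ ⟨k, rfl, -⟩
      exact encard_neighborSet_rerouted_inr hπ hπM huv k
    · rintro _ (y | j) hadj ⟨k, rfl, hk⟩ hj
      · rw [rerouted_adj_inr_inl] at hadj
        rcases hadj with ⟨rfl, h1⟩ | ⟨rfl, h1⟩
        · omega
        · rw [hπ (show π k = π i by omega)]
      · rw [rerouted_adj_inr_inr] at hadj
        have : ¬ c ≤ π j := fun h => hj ⟨j, rfl, h⟩
        omega

/-- T is the part of the pendant path between the edge and the cut. -/
theorem not_isInternalPair_rerouted_inr_inr (hπ : Function.Injective π) (hπM : ∀ i, π i < M)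
    (huv : H.Adj u v) (hc0 : 0 < c) (hcM : c < M) (i j : Fin M) :
    ¬ IsInternalPair (rerouted H u v π c M) (.inr i) (.inr j) := by
  suffices key : ∀ i j, π j = π i + 1 → π j ≠ c →
      ¬ IsInternalPair (rerouted H u v π c M) (.inr i) (.inr j) by
    intro h
    rcases rerouted_adj_inr_inr.1 h.1 with h1 | h1
    · exact key i j h1.1 h1.2 h
    · exact key j i h1.1 h1.2 h.symm
  intro i j hij hjc
  by_cases hlt : π j < c
  · refine mt IsInternalPair.symm (not_isInternalPair_of_closed
      {z | ∃ k, z = .inr k ∧ π j ≤ π k ∧ π k < c} ⟨j, rfl, le_rfl, hlt⟩ ?_ ?_ ?_)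
    · rintro ⟨k, hk, hk'⟩
      cases hk
      omega
    · rintro _ ⟨k, rfl, -⟩
      exact encard_neighborSet_rerouted_inr hπ hπM huv k
    · rintro _ (y | l) hadj ⟨k, rfl, hk⟩ hl
      · rw [rerouted_adj_inr_inl] at hadj
        omega
      · rw [rerouted_adj_inr_inr] at hadj
        have : ¬ (π j ≤ π l ∧ π l < c) := fun h => hl ⟨l, rfl, h⟩
        rw [hπ (show π k = π j by omega), hπ (show π l = π i by omega)]
  · refine not_isInternalPair_of_closed
      {z | ∃ k, z = .inr k ∧ c ≤ π k ∧ π k ≤ π i} ⟨i, rfl, by omega, le_rfl⟩ ?_ ?_ ?_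
    · rintro ⟨k, hk, hk'⟩
      cases hk
      omega
    · rintro _ ⟨k, rfl, -⟩
      exact encard_neighborSet_rerouted_inr hπ hπM huv k
    · rintro _ (y | l) hadj ⟨k, rfl, hk⟩ hl
      · rw [rerouted_adj_inr_inl] at hadj
        have := hπM j
        omega
      · rw [rerouted_adj_inr_inr] at hadj
        have : ¬ (c ≤ π l ∧ π l ≤ π i) := fun h => hl ⟨l, rfl, h⟩
        rw [hπ (show π k = π i by omega), hπ (show π l = π j by omega)]

theorem IsInternalPair.of_rerouted (hπ : Function.Injective π) (hπM : ∀ i, π i < M)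
    (huv : H.Adj u v) (hc0 : 0 < c) (hcM : c < M) {x y : V}
    (h : IsInternalPair (rerouted H u v π c M) (.inl x) (.inl y)) : IsInternalPair H x y := by
  classical
  -- ρ contracts each pendant path to the vertex that carries it.
  set ρ : V ⊕ Fin M → V := Sum.elim id fun i => if π i < c then u else v with hρ
  have hside : ∀ z i, (z = u ∧ π i = 0) ∨ (z = v ∧ π i + 1 = M) → ρ (.inr i) = z := by
    rintro z i (⟨rfl, h0⟩ | ⟨rfl, h0⟩)
    · exact if_pos (by omega)
    · exact if_neg (by omega)
  have hr : ∀ z w, ((rerouted H u v π c M).deleteEdges {s(.inl x, .inl y)}).Reachable z w →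
      (H.deleteEdges {s(x, y)}).Reachable (ρ z) (ρ w) := by
    refine fun z w => SimpleGraph.Reachable.lift ρ ?_
    rintro (z | i) (w | j) hzw <;> rw [SimpleGraph.deleteEdges_adj] at hzw
    · refine SimpleGraph.Adj.reachable ?_
      rw [SimpleGraph.deleteEdges_adj]
      refine ⟨hzw.1.1, fun h' => hzw.2 ?_⟩
      have h'' : s(z, w) = s(x, y) := h'
      exact congrArg (Sym2.map Sum.inl) h''
    · rw [hside z j (rerouted_adj_inl_inr.1 hzw.1)]
      exact SimpleGraph.Reachable.refl _
    · rw [hside w i (rerouted_adj_inr_inl.1 hzw.1)]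
      exact SimpleGraph.Reachable.refl _
    · have h1 := rerouted_adj_inr_inr.1 hzw.1
      have h2 : ρ (.inr i) = ρ (.inr j) := by
        have h3 : π i < c ↔ π j < c := by omega
        simp [hρ, h3]
      rw [h2]
  have hd : ∀ z, 3 ≤ ((rerouted H u v π c M).neighborSet z).encard →
      3 ≤ (H.neighborSet (ρ z)).encard := by
    rintro (z | i) hz
    · exact hz.trans (encard_neighborSet_rerouted_inl hπ z huv)
    · exact absurd hz (encard_neighborSet_rerouted_inr hπ hπM huv i)
  obtain ⟨hxy, h⟩ := h
  refine ⟨hxy.1, ?_⟩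
  rcases h with h | ⟨r, s, hr3, hs3, hrx, hsy⟩
  · exact Or.inl (hr _ _ h)
  · exact Or.inr ⟨ρ r, ρ s, hd r hr3, hd s hs3, hr _ _ hrx, hr _ _ hsy⟩

/-- The pendant paths contribute no internal edge, the surviving ones were internal in H, and uv is
gone. -/
theorem internalEdgeCount_rerouted_lt [Finite V] (hπ : Function.Injective π) (hπM : ∀ i, π i < M)
    (huv : IsInternalPair H u v) (hc0 : 0 < c) (hcM : c < M) :
    internalEdgeCount (rerouted H u v π c M) < internalEdgeCount H := by
  have hsub : internalEdges (rerouted H u v π c M) ⊆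
      Sym2.map Sum.inl '' (internalEdges H \ {s(u, v)}) := by
    intro e
    induction e with
    | h p q =>
      intro h
      rw [mk_mem_internalEdges] at h
      rcases p with x | i <;> rcases q with y | j
      · exact ⟨s(x, y), ⟨mk_mem_internalEdges.2 (h.of_rerouted hπ hπM huv.1 hc0 hcM), h.1.2⟩, rfl⟩
      · exact absurd h.symm (not_isInternalPair_rerouted_inr_inl hπ hπM huv.1 hc0 hcM j x)
      · exact absurd h (not_isInternalPair_rerouted_inr_inl hπ hπM huv.1 hc0 hcM i y)
      · exact absurd h (not_isInternalPair_rerouted_inr_inr hπ hπM huv.1 hc0 hcM i j)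
  calc (internalEdges (rerouted H u v π c M)).ncard
      ≤ (Sym2.map Sum.inl '' (internalEdges H \ {s(u, v)}) : Set (Sym2 (V ⊕ Fin M))).ncard :=
        Set.ncard_le_ncard hsub (Set.toFinite _)
    _ ≤ (internalEdges H \ {s(u, v)}).ncard := Set.ncard_image_le (Set.toFinite _)
    _ < (internalEdges H).ncard :=
        Set.ncard_sdiff_singleton_lt_of_mem (mk_mem_internalEdges.2 huv) (Set.toFinite _)

end Rerouted

/-- Negative instances: the line is cut and `v` is attached to its end. -/
theorem not_isTopologicalMinor_rerouted {V : Type} [Finite V] {H : SimpleGraph V} {u v : V} {M c : ℕ}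
    (π : Equiv.Perm (Fin M)) (huv : IsInternalPair H u v) (hc0 : 0 < c) (hcM : c < M) :
    ¬ IsTopologicalMinor H (rerouted H u v (fun i => (π i : ℕ)) c M) := fun h =>
  (internalEdgeCount_rerouted_lt (fun _ _ h => π.injective (Fin.ext h)) (fun i => (π i).2) huv hc0
    hcM).not_ge h.finite_and_internalEdgeCount_le.2

/-- Positive instances: `u` and `v` are joined by the first part of the line. -/
theorem isTopologicalMinor_rerouted {V : Type} [Finite V] {H : SimpleGraph V} {u v : V} {M b : ℕ}
    (π : Equiv.Perm (Fin M)) (huv : H.Adj u v) (hb0 : 0 < b) (hbM : b ≤ M) :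
    IsTopologicalMinor H (rerouted H u v (fun i => (π i : ℕ)) b b) := by
  -- For i > 0, `g i` is the vertex at position i - 1, since `g 0` is u.
  set g : ℕ → V ⊕ Fin M := fun i =>
    if h : 0 < i ∧ i ≤ b then .inr (π.symm ⟨i - 1, by omega⟩) else .inl u with hg
  have hg1 : ∀ i, 0 < i → (hi : i ≤ b) → g i = .inr (π.symm ⟨i - 1, by omega⟩) :=
    fun i h0 hi => dif_pos ⟨h0, hi⟩
  have hg0 : g 0 = .inl u := dif_neg (by omega)
  refine .of_path huv (f := Sum.inl) Sum.inl_injective (g := g) (b := b) (fun x y h1 h2 => ⟨h1, h2⟩)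
    hg0 ?_ ?_ ?_ ?_
  · intro i h0 hi x
    rw [hg1 i h0 hi]
    exact Sum.inr_ne_inl
  · intro i j h0 hij hj h
    rw [hg1 i h0 (by omega), hg1 j (by omega) hj] at h
    have := π.symm.injective (Sum.inr_injective h)
    rw [Fin.mk.injEq] at this
    omega
  · intro i hi
    rw [hg1 (i + 1) (by omega) (by omega)]
    by_cases h0 : i = 0
    · subst h0
      rw [hg0, rerouted_adj_inl_inr]
      left
      simp
    · rw [hg1 i (by omega) (by omega), rerouted_adj_inr_inr]
      left
      simp only [Equiv.apply_symm_apply]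
      omega
  · rw [hg1 b hb0 le_rfl, rerouted_adj_inr_inl]
    right
    simp only [Equiv.apply_symm_apply]
    exact ⟨trivial, by omega⟩

/-! ### Block swaps on the line -/

/-- The map that exchanges the second and the fourth of the blocks into which the numbers below `M`
are cut in front of `i`, `b` and `j`. -/
def blockSwap (M i b j t : ℕ) : ℕ :=
  if t < i then t else if t < b then t + (M - b) else if t < j then t + (i + M) - (j + b)
  else t - j + i

theorem blockSwap_lt {M i b j t : ℕ} (hib : i < b) (hbj : b < j) (hjM : j < M) (ht : t < M) :
    blockSwap M i b j t < M := by
  unfold blockSwap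
  split_ifs <;> omega

/-- The order 1 4 3 2 has its cuts in front of i, i + M - j and i + M - b; swapping again restores 1
2 3 4. -/
theorem blockSwap_blockSwap {M i b j t : ℕ} (hib : i < b) (hbj : b < j) (hjM : j < M) (ht : t < M) :
    blockSwap M i (i + M - j) (i + M - b) (blockSwap M i b j t) = t := by
  unfold blockSwap
  split_ifs <;> omega

/-- Adjacency on the line that is cut in front of `c`. -/
def lineAdj (c s t : ℕ) : Prop := (t = s + 1 ∧ t ≠ c) ∨ (s = t + 1 ∧ s ≠ c)

open Classical in
/-- The pairs `(i, j)` of cuts for which a block swap may change the adjacency of `s` and `t`. -/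
noncomputable def changePairs (M c s t : ℕ) : Finset (ℕ × ℕ) :=
  if lineAdj c s t then {max s t} ×ˢ Finset.range M ∪ Finset.range M ×ˢ {max s t}
  else {(s + 1, t), (t, s + 1), (t + 1, s), (s, t + 1)}

/-- The swap loses the edges in front of i and j and gains the pairs (i - 1, j) and (j - 1, i). So a
lost edge has i or j as its larger end, and a gained pair leaves four choices for (i, j). -/
theorem mem_changePairs {M i b j s t : ℕ} (hi : 0 < i) (hib : i < b) (hbj : b < j) (hjM : j < M)
    (hs : s < M) (ht : t < M)
    (h : ¬ (lineAdj b s t ↔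
      lineAdj (i + M - j) (blockSwap M i b j s) (blockSwap M i b j t))) :
    (i, j) ∈ changePairs M b s t := by
  unfold changePairs
  by_cases h1 : lineAdj b s t
  · rw [if_pos h1]
    simp only [Finset.mem_union, Finset.mem_product, Finset.mem_singleton, Finset.mem_range]
    have h2 : ¬ lineAdj (i + M - j) (blockSwap M i b j s) (blockSwap M i b j t) := by tauto
    unfold lineAdj at h1 h2
    unfold blockSwap at h2
    rcases h1 with h1 | h1 <;> split_ifs at h2 <;> omega
  · rw [if_neg h1]
    simp only [Finset.mem_insert, Finset.mem_singleton, Prod.mk.injEq]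
    have h2 : lineAdj (i + M - j) (blockSwap M i b j s) (blockSwap M i b j t) :=
      by_contra fun h2 => h (iff_of_false h1 h2)
    unfold lineAdj at h1 h2
    unfold blockSwap at h2
    split_ifs at h2 <;> omega

theorem mem_changePairs_swap {M i b j s t : ℕ} (hi : 0 < i) (hib : i < b) (hbj : b < j) (hjM : j < M)
    (hs : s < M) (ht : t < M)
    (h : ¬ (lineAdj b s t ↔
      lineAdj (i + M - j) (blockSwap M i b j s) (blockSwap M i b j t))) :
    (i, i + M - b) ∈ changePairs M (i + M - j) (blockSwap M i b j s) (blockSwap M i b j t) := by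
  refine mem_changePairs hi (by omega) (by omega) (by omega) (blockSwap_lt hib hbj hjM hs)
    (blockSwap_lt hib hbj hjM ht) ?_
  rw [blockSwap_blockSwap hib hbj hjM hs, blockSwap_blockSwap hib hbj hjM ht,
    show i + M - (i + M - b) = b by omega]
  exact fun h' => h h'.symm

/-- The block swap as a permutation. -/
def blockPerm {M i b j : ℕ} (hib : i < b) (hbj : b < j) (hjM : j < M) : Equiv.Perm (Fin M) where
  toFun t := ⟨blockSwap M i b j t, blockSwap_lt hib hbj hjM t.2⟩
  invFun t := ⟨blockSwap M i (i + M - j) (i + M - b) t,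
    blockSwap_lt (by omega) (by omega) (by omega) t.2⟩
  left_inv t := Fin.ext (blockSwap_blockSwap hib hbj hjM t.2)
  right_inv t := Fin.ext (by
    have := blockSwap_blockSwap (M := M) (i := i) (b := i + M - j) (j := i + M - b) (t := t)
      (by omega) (by omega) (by omega) t.2
    rwa [show i + M - (i + M - b) = b by omega, show i + M - (i + M - j) = j by omega] at this)

section Differences

variable {V : Type*} {H : SimpleGraph V} {u v : V} {M : ℕ}

/-- The swap fixes position 0 and sends b - 1 to M - 1, so u and v keep their neighbours on the line
and only pairs of line vertices change. -/
theorem rerouted_differ {i b j : ℕ} (hi : 0 < i) (hib : i < b) (hbj : b < j) (hjM : j < M)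
    {π ρ : Fin M → ℕ} (hπM : ∀ x, π x < M) (hρ : ∀ x, ρ x = blockSwap M i b j (π x))
    {z w : V ⊕ Fin M} (h : ¬ ((rerouted H u v π b b).Adj z w ↔
      (rerouted H u v ρ (i + M - j) M).Adj z w)) :
    ∃ x y, z = .inr x ∧ w = .inr y ∧ (i, j) ∈ changePairs M b (π x) (π y) ∧
      (i, i + M - b) ∈ changePairs M (i + M - j) (ρ x) (ρ y) := by
  have hmix : ∀ (x : V) (k : Fin M), ((x = u ∧ π k = 0) ∨ (x = v ∧ π k + 1 = b)) ↔
      ((x = u ∧ ρ k = 0) ∨ (x = v ∧ ρ k + 1 = M)) := by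
    intro x k
    have h1 := hπM k
    have h2 : π k = 0 ↔ ρ k = 0 := by
      rw [hρ]
      unfold blockSwap
      split_ifs <;> omega
    have h3 : π k + 1 = b ↔ ρ k + 1 = M := by
      rw [hρ]
      unfold blockSwap
      split_ifs <;> omega
    rw [h2, h3]
  rcases z with z | x <;> rcases w with w | y
  · exact absurd Iff.rfl h
  · exact absurd (hmix z y) h
  · exact absurd (hmix w x) h
  · refine ⟨x, y, rfl, rfl, ?_⟩
    rw [hρ, hρ]
    have h' : ¬ (lineAdj b (π x) (π y) ↔ lineAdj (i + M - j) (blockSwap M i b j (π x))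
        (blockSwap M i b j (π y))) := by
      rw [← hρ, ← hρ]
      exact h
    exact ⟨mem_changePairs hi hib hbj hjM (hπM x) (hπM y) h',
      mem_changePairs_swap hi hib hbj hjM (hπM x) (hπM y) h'⟩

/-- κ = M^(-1/2) balances O(M) changes at an edge against at most 4 at a non-edge. -/
theorem cost_mul_card_le {n : ℕ} {κ : ℝ} (hκ : 0 < κ) (hM : κ ^ 2 * M = 1)
    (e : V ⊕ Fin M ≃ Fin n) {π : Fin M → ℕ} {c d : ℕ} {R : Type*} (F : Finset R) (g : R → ℕ × ℕ)
    (hg : Set.InjOn g F) (p : Fin n × Fin n)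
    (hF : ∀ r ∈ F, ∃ x y, e.symm p.1 = .inr x ∧ e.symm p.2 = .inr y ∧
      g r ∈ changePairs M c (π x) (π y)) :
    pairCost κ ((rerouted H u v π c d).comap e.symm) p * F.card ≤ 4 * κ⁻¹ := by
  rcases F.eq_empty_or_nonempty with rfl | ⟨r₀, hr₀⟩
  · simp only [Finset.card_empty, Nat.cast_zero, mul_zero]
    positivity
  obtain ⟨x, y, hx, hy, -⟩ := hF r₀ hr₀
  have hcard : F.card ≤ (changePairs M c (π x) (π y)).card := by
    refine Finset.card_le_card_of_injOn g (fun r hr => ?_) hg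
    obtain ⟨x', y', hx', hy', h⟩ := hF r hr
    rw [hx] at hx'
    rw [hy] at hy'
    rw [Sum.inr_injective hx', Sum.inr_injective hy']
    exact h
  have hadj : ((rerouted H u v π c d).comap e.symm).Adj p.1 p.2 ↔ lineAdj c (π x) (π y) := by
    rw [SimpleGraph.comap_adj, hx, hy]
    rfl
  unfold pairCost
  by_cases h : lineAdj c (π x) (π y)
  · rw [if_pos (hadj.2 h)]
    have h1 : F.card ≤ 4 * M := by
      refine hcard.trans ?_
      rw [changePairs, if_pos h]
      refine (Finset.card_union_le _ _).trans ?_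
      simp only [Finset.card_product, Finset.card_singleton, Finset.card_range]
      omega
    calc κ * F.card ≤ κ * (4 * M) := by gcongr; exact_mod_cast h1
      _ = 4 * (κ ^ 2 * M) * κ⁻¹ := by field_simp
      _ = 4 * κ⁻¹ := by rw [hM, mul_one]
  · rw [if_neg (mt hadj.1 h)]
    have h1 : F.card ≤ 4 := by
      refine hcard.trans ?_
      rw [changePairs, if_neg h]
      exact Finset.card_le_four
    have h2 : (F.card : ℝ) ≤ 4 := by exact_mod_cast h1
    calc κ⁻¹ * F.card ≤ κ⁻¹ * 4 := by gcongr
      _ = 4 * κ⁻¹ := mul_comm _ _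

end Differences

/-! ### The query lower bound -/

theorem query_lower_bound {V : Type} [Finite V] {H : SimpleGraph V} {u v : V}
    (huv : IsInternalPair H u v) {n M k : ℕ} (hkM : 3 * k < M) (e : V ⊕ Fin M ≃ Fin n)
    (A : QueryAlgorithm n) (hA : A.Decides (topologicalMinorContainment H n)) :
    (k : ℝ) ^ 3 ≤ 288 * (M * √M) * A.queries := by
  classical
  have hM0 : (0 : ℝ) < M := by exact_mod_cast (by omega : 0 < M)
  have hiso : ∀ {π : Fin M → ℕ} {c d : ℕ},
      topologicalMinorContainment H n ((rerouted H u v π c d).comap e.symm) ↔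
      IsTopologicalMinor H (rerouted H u v π c d) := fun {π c d} =>
    ⟨fun h => .iso h (SimpleGraph.Iso.comap e.symm _),
      fun h => .iso h (SimpleGraph.Iso.comap e.symm _).symm⟩
  -- A related pair is a labelling of the line with independent cuts i in [1, k], b in [k + 1, 2k],
  -- j in [2k + 1, 3k].
  let R := Equiv.Perm (Fin M) × Fin k × Fin k × Fin k
  let ci : R → ℕ := fun r => r.2.1 + 1
  let cb : R → ℕ := fun r => k + 1 + r.2.2.1
  let cj : R → ℕ := fun r => 2 * k + 1 + r.2.2.2
  have hi : ∀ r, 0 < ci r := fun r => Nat.succ_pos _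
  have hib : ∀ r, ci r < cb r := fun r => by
    have := r.2.1.2
    simp only [ci, cb]
    omega
  have hbj : ∀ r, cb r < cj r := fun r => by
    have := r.2.2.1.2
    simp only [cb, cj]
    omega
  have hjM : ∀ r, cj r < M := fun r => by
    have := r.2.2.2.2
    simp only [cj]
    omega
  let θ : R → Equiv.Perm (Fin M) := fun r => blockPerm (hib r) (hbj r) (hjM r)
  have hθ : ∀ r r', ci r = ci r' → cb r = cb r' → cj r = cj r' → θ r = θ r' := by
    intro r r' h1 h2 h3
    ext t
    simp only [θ, blockPerm, Equiv.coe_fn_mk, h1, h2, h3]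
  have hext : ∀ r r' : R, r.1 = r'.1 → ci r = ci r' → cb r = cb r' → cj r = cj r' → r = r' := by
    rintro ⟨σ, a, b, c⟩ ⟨σ', a', b', c'⟩ h0 h1 h2 h3
    simp only [ci, cb, cj] at h0 h1 h2 h3
    rw [h0, Fin.ext (show (a : ℕ) = a' by omega), Fin.ext (show (b : ℕ) = b' by omega),
      Fin.ext (show (c : ℕ) = c' by omega)]
  let X := Equiv.Perm (Fin M) × Fin M
  -- The positive instance remembers the labelling and b, the negative one the swapped labelling and
  -- the new cut i + M - j.
  let px : R → X := fun r => (r.1, ⟨cb r, (hbj r).trans (hjM r)⟩)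
  let py : R → X := fun r => (θ r * r.1, ⟨ci r + M - cj r, by
    have := hib r
    have := hbj r
    have := hjM r
    omega⟩)
  let GX : X → SimpleGraph (Fin n) := fun x =>
    (rerouted H u v (fun t => (x.1 t : ℕ)) x.2 x.2).comap e.symm
  let GY : X → SimpleGraph (Fin n) := fun x =>
    (rerouted H u v (fun t => (x.1 t : ℕ)) x.2 M).comap e.symm
  have hdiff : ∀ r (p : Fin n × Fin n),
      ¬ ((GX (px r)).Adj p.1 p.2 ↔ (GY (py r)).Adj p.1 p.2) →
      ∃ x y, e.symm p.1 = .inr x ∧ e.symm p.2 = .inr y ∧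
      (ci r, cj r) ∈ changePairs M (cb r) (r.1 x) (r.1 y) ∧
      (ci r, ci r + M - cb r) ∈ changePairs M (ci r + M - cj r) ((θ r * r.1) x) ((θ r * r.1) y) :=
    fun r p h => rerouted_differ (hi r) (hib r) (hbj r) (hjM r) (fun x => (r.1 x).2)
      (fun x => rfl) h
  have hκ : 0 < (√M)⁻¹ := by positivity
  have hκM : ((√M)⁻¹) ^ 2 * (M : ℝ) = 1 := by
    rw [inv_pow, Real.sq_sqrt hM0.le, inv_mul_cancel₀ hM0.ne']
  have main := adversary_bound hA px py GX GY
    (fun r => hiso.2 (isTopologicalMinor_rerouted r.1 huv.1 (by have := hib r; simp only [px]; omega)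
      (px r).2.2.le))
    (fun r => mt hiso.1 (not_isTopologicalMinor_rerouted (θ r * r.1) huv
      (by have := hi r; have := hjM r; simp only [py]; omega) (py r).2.2))
    hκ (B := 4 * √M) ?_ ?_
  · have hR : Fintype.card R = M.factorial * k ^ 3 := by
      simp only [R, Fintype.card_prod, Fintype.card_perm, Fintype.card_fin]
      ring
    have hX : Fintype.card X = M.factorial * M := by
      simp only [X, Fintype.card_prod, Fintype.card_perm, Fintype.card_fin]
    -- The constant is 288 = 36 · 4 · 2, both sides being indexed by X.
    rw [hR, hX] at main
    push_cast at main
    have hf : (0 : ℝ) < M.factorial := by exact_mod_cast M.factorial_pos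
    refine le_of_mul_le_mul_left (main.trans (le_of_eq ?_)) hf
    ring
  · intro x p
    have := cost_mul_card_le (H := H) (u := u) (v := v) (d := x.2) hκ hκM e
      (π := fun t => (x.1 t : ℕ)) (c := x.2)
      (Finset.univ.filter fun r => px r = x ∧
        ¬ ((GX (px r)).Adj p.1 p.2 ↔ (GY (py r)).Adj p.1 p.2)) (fun r => (ci r, cj r)) ?_ p ?_
    · rw [inv_inv] at this
      convert this
    · intro r hr r' hr' h
      have h1 := (Finset.mem_filter.1 hr).2.1.trans (Finset.mem_filter.1 hr').2.1.symm
      rw [Prod.mk.injEq] at h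
      exact hext r r' (congrArg (fun x : X => x.1) h1) h.1 (congrArg (fun x : X => (x.2 : ℕ)) h1) h.2
    · intro r hr
      obtain ⟨h1, h2⟩ := (Finset.mem_filter.1 hr).2
      obtain ⟨s, t, hs, ht, h3, -⟩ := hdiff r p h2
      rw [← h1]
      exact ⟨s, t, hs, ht, h3⟩
  · intro x p
    have := cost_mul_card_le (H := H) (u := u) (v := v) (d := M) hκ hκM e
      (π := fun t => (x.1 t : ℕ)) (c := x.2)
      (Finset.univ.filter fun r => py r = x ∧
        ¬ ((GX (px r)).Adj p.1 p.2 ↔ (GY (py r)).Adj p.1 p.2))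
      (fun r => (ci r, ci r + M - cb r)) ?_ p ?_
    · rw [inv_inv] at this
      convert this
    · intro r hr r' hr' h
      have h1 := (Finset.mem_filter.1 hr).2.1.trans (Finset.mem_filter.1 hr').2.1.symm
      simp only [Prod.mk.injEq] at h
      have h2 : ci r + M - cj r = ci r' + M - cj r' := congrArg (fun x : X => (x.2 : ℕ)) h1
      -- Given i, the second entry yields b and the cut yields j. The swap is then known and cancels
      -- from the labelling.
      have hb : cb r = cb r' := by
        have := hbj r
        have := hjM r
        have := hbj r'
        have := hjM r'
        omega
      have hj : cj r = cj r' := by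
        have := hjM r
        have := hjM r'
        omega
      have h3 : θ r * r.1 = θ r' * r'.1 := congrArg (fun x : X => x.1) h1
      rw [hθ r r' h.1 hb hj] at h3
      exact hext r r' (mul_left_cancel h3) h.1 hb hj
    · intro r hr
      obtain ⟨h1, h2⟩ := (Finset.mem_filter.1 hr).2
      obtain ⟨s, t, hs, ht, -, h3⟩ := hdiff r p h2
      rw [← h1]
      exact ⟨s, t, hs, ht, h3⟩

/-! ### Inequivalence and the main theorem -/

theorem exists_isInternalPair {V : Type*} {H : SimpleGraph V} (h : 0 < internalEdgeCount H) :
    ∃ u v, IsInternalPair H u v := by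
  obtain ⟨e, he⟩ := Set.nonempty_of_ncard_ne_zero h.ne'
  induction e with
  | h u v => exact ⟨u, v, mk_mem_internalEdges.1 he⟩

/-- There is no position M, so the line is uncut. A copy of H misses one of the M - 1 > |V| positive
positions t, hence survives a cut in front of t, which leaves too few internal edges. -/
theorem not_isContained_rerouted {V : Type} [Finite V] {H : SimpleGraph V} {u v : V}
    (huv : IsInternalPair H u v) {M : ℕ} (hM : Nat.card V + 1 < M) :
    ¬ H.IsContained (rerouted H u v (fun i : Fin M => (i : ℕ)) M M) := by
  rintro ⟨f⟩
  have hmiss : ∃ t : Fin M, 0 < (t : ℕ) ∧ ∀ x, f x ≠ .inr t := by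
    by_contra! h
    have h' : ∀ t : Fin (M - 1), ∃ x, f x = .inr ⟨t + 1, by omega⟩ := fun t => h _ (Nat.succ_pos _)
    choose g hg using h'
    have hginj : Function.Injective g := by
      intro s t hst
      have h1 := (hg s).symm.trans ((congrArg f hst).trans (hg t))
      have h2 := Sum.inr_injective h1
      rw [Fin.mk.injEq] at h2
      exact Fin.ext (by omega)
    have := Nat.card_le_card_of_injective g hginj
    rw [Nat.card_eq_fintype_card, Fintype.card_fin] at this
    omega
  obtain ⟨t, ht0, ht⟩ := hmiss
  refine (internalEdgeCount_rerouted_lt (π := fun i : Fin M => (i : ℕ)) (fun _ _ h => Fin.ext h)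
    (fun i => i.2) huv ht0 t.2).not_ge
    (internalEdgeCount_le_of_injective ⟨f, fun {x y} hxy => ?_⟩ f.injective)
  have h := f.toHom.map_adj hxy
  rw [SimpleGraph.Copy.toHom_apply, SimpleGraph.Copy.toHom_apply] at h
  have hx := ht x
  have hy := ht y
  revert h hx hy
  generalize f x = z
  generalize f y = w
  intro h hx hy
  rcases z with z | i <;> rcases w with w | j
  · exact h
  · exact h
  · exact h
  · rw [rerouted_adj_inr_inr] at h ⊢
    have h1 : (i : ℕ) ≠ t := fun h => hx (congrArg Sum.inr (Fin.ext h))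
    have h2 : (j : ℕ) ≠ t := fun h => hy (congrArg Sum.inr (Fin.ext h))
    omega

theorem not_equivalentProperties_of_isInternalPair {V : Type} [Finite V] {H : SimpleGraph V}
    {u v : V} (huv : IsInternalPair H u v) :
    ¬ EquivalentProperties (topologicalMinorContainment H) (subgraphContainment H) := by
  intro h
  obtain ⟨M, hM⟩ : ∃ M, Nat.card V + 1 < M := ⟨_, Nat.lt_succ_self _⟩
  let e := Finite.equivFin (V ⊕ Fin M)
  let G := rerouted H u v (fun i : Fin M => (i : ℕ)) M M
  let φ : G.comap e.symm ≃g G := SimpleGraph.Iso.comap e.symm G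
  have h1 : IsTopologicalMinor H G :=
    isTopologicalMinor_rerouted (Equiv.refl (Fin M)) huv.1 (by omega) le_rfl
  have h2 : H.IsContained (G.comap e.symm) := (h _ (G.comap e.symm)).1 (.iso h1 φ.symm)
  exact not_isContained_rerouted huv hM (h2.trans φ.isContained)

theorem subgraphContainment.topologicalMinorContainment {V : Type*} {H : SimpleGraph V}
    {V' : Type} {H' : SimpleGraph V'} (φ : H ≃g H') {n : ℕ} {G : SimpleGraph (Fin n)}
    (h : subgraphContainment H n G) : topologicalMinorContainment H n G :=
  IsTopologicalMinor.of_isContained (.self φ) (φ.isContained'.trans h)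

theorem IsTopologicalMinor.congr_left {V V' : Type*} {H : SimpleGraph V} {H' : SimpleGraph V'}
    (φ : H ≃g H') {W : Type} {G : SimpleGraph W} (h : IsTopologicalMinor H G) :
    IsTopologicalMinor H' G := by
  induction h with
  | self e => exact .self (φ.symm.trans e)
  | iso _ e ih => exact .iso ih e
  | addEdges _ hle ih => exact .addEdges ih hle
  | addVertex _ ih => exact .addVertex ih
  | subdivide _ huv ih => exact .subdivide ih huv

theorem exists_rpow_lower_bound {V : Type} [Finite V] {H : SimpleGraph V} {u v : V}
    (huv : IsInternalPair H u v) :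
    ∃ c : ℝ, 0 < c ∧ ∃ n₀ : ℕ, ∀ n : ℕ, n₀ ≤ n →
      ENNReal.ofReal (c * (n : ℝ) ^ (3 / 2 : ℝ)) ≤
        (quantumQueryComplexity (topologicalMinorContainment H n) : ℝ≥0∞) := by
  -- Here 62208 = 288 · 6³ comes from k ≥ M/6, and the power of 1/2 from M ≥ n/2.
  refine ⟨(1 / 2) ^ (3 / 2 : ℝ) / 62208, by positivity, 2 * Nat.card V + 12, fun n hn =>
    le_quantumQueryComplexity fun A hA => ?_⟩
  obtain ⟨M, hM⟩ : ∃ M, Nat.card V + M = n := ⟨n - Nat.card V, by omega⟩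
  have e : V ⊕ Fin M ≃ Fin n := Finite.equivFinOfCardEq (by simp [hM])
  have h := query_lower_bound huv (k := (M - 1) / 3) (by omega) e A hA
  have hk : (M : ℝ) / 6 ≤ ((M - 1) / 3 : ℕ) := by
    rw [div_le_iff₀ (by norm_num)]
    exact_mod_cast (by omega : M ≤ (M - 1) / 3 * 6)
  have hM0 : (0 : ℝ) < M := by exact_mod_cast (by omega : 0 < M)
  have hnM : 1 / 2 * (n : ℝ) ≤ M := by
    have : (n : ℝ) ≤ 2 * M := by exact_mod_cast (by omega : n ≤ 2 * M)
    linarith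
  have hpow : (M : ℝ) ^ (3 / 2 : ℝ) = M * √M := by
    rw [Real.sqrt_eq_rpow, ← Real.rpow_one_add' hM0.le (by norm_num)]
    norm_num
  have h1 : ((M : ℝ) / 6) ^ 3 ≤ 288 * (M * √M) * A.queries := le_trans (by gcongr) h
  have h2 : (M : ℝ) * √M * (M * √M) = M ^ 3 := by
    linear_combination (M : ℝ) ^ 2 * Real.mul_self_sqrt hM0.le
  have h3 : (M : ℝ) * √M ≤ 62208 * A.queries := by
    refine le_of_mul_le_mul_left ?_ (show 0 < (M : ℝ) * √M by positivity)
    rw [h2]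
    linarith
  calc (1 / 2) ^ (3 / 2 : ℝ) / 62208 * (n : ℝ) ^ (3 / 2 : ℝ)
      = (1 / 2 * (n : ℝ)) ^ (3 / 2 : ℝ) / 62208 := by
        rw [Real.mul_rpow (by norm_num) (Nat.cast_nonneg n)]
        ring
    _ ≤ (M : ℝ) ^ (3 / 2 : ℝ) / 62208 := by gcongr
    _ ≤ A.queries := by
        rw [hpow, div_le_iff₀ (by norm_num)]
        linarith

theorem mainTheorem10 {V : Type*} [Finite V] (H : SimpleGraph V) :
    (¬ EquivalentProperties (topologicalMinorContainment H) (subgraphContainment H) ↔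
        0 < internalEdgeCount H) ∧
    (¬ EquivalentProperties (topologicalMinorContainment H) (subgraphContainment H) →
      ∃ c : ℝ, 0 < c ∧ ∃ n₀ : ℕ, ∀ n : ℕ, n₀ ≤ n →
        ENNReal.ofReal (c * (n : ℝ) ^ (3 / 2 : ℝ)) ≤
          (quantumQueryComplexity (topologicalMinorContainment H n) : ℝ≥0∞)) := by
  -- The instances live on V ⊕ Fin M, which has to be in `Type`, so H is moved to a vertex set `Fin
  -- _`.
  obtain ⟨H', ⟨φ⟩⟩ : ∃ H' : SimpleGraph (Fin (Nat.card V)), Nonempty (H ≃g H') :=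
    ⟨_, ⟨SimpleGraph.Iso.map (Finite.equivFin V) H⟩⟩
  have htop : topologicalMinorContainment H = topologicalMinorContainment H' := by
    funext n G
    exact propext ⟨fun h => h.congr_left φ, fun h => h.congr_left φ.symm⟩
  have hsub : subgraphContainment H = subgraphContainment H' := by
    funext n G
    exact propext (SimpleGraph.isContained_congr_left φ)
  have hcount : internalEdgeCount H = internalEdgeCount H' :=
    le_antisymm (internalEdgeCount_le_of_isContained φ.isContained)
      (internalEdgeCount_le_of_isContained φ.isContained')
  rw [htop, hsub, hcount]
  have hiff : ¬ EquivalentProperties (topologicalMinorContainment H') (subgraphContainment H') ↔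
      0 < internalEdgeCount H' := by
    constructor
    · intro h
      by_contra h0
      exact h fun n G => ⟨fun h' => IsTopologicalMinor.isContained (by omega) h',
        fun h' => h'.topologicalMinorContainment .refl⟩
    · intro h
      obtain ⟨u, v, huv⟩ := exists_isInternalPair h
      exact not_equivalentProperties_of_isInternalPair huv
  refine ⟨hiff, fun h => ?_⟩
  obtain ⟨u, v, huv⟩ := exists_isInternalPair (hiff.1 h)
  exact exists_rpow_lower_bound huv
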